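/- Let $\mathbb{F}_q$ be a finite field with $q$ elements, and let $\operatorname{GA}_n(\mathbb{F}_q)$ be the group, under composition, of polynomial automorphisms $F=(F_1,\ldots,F_n)$, $F_i\in\mathbb{F}_q[X_1,\ldots,X_n]$, that is, of polynomial maps having a polynomial inverse. The tame subgroup $\operatorname{TA}_n(\mathbb{F}_q)$ is the subgroup generated by the affine automorphisms (all components of degree at most $1$) and the elementary automorphisms $(X_1,\ldots,X_{i-1},X_i+X^{\alpha},X_{i+1},\ldots,X_n)$, where $X^{\alpha}$ is a monomial not involving $X_i$. For $m\ge 1$, every $F\in\operatorname{GA}_n(\mathbb{F}_q)$ induces a bijection $\pi_{q^m}(F)$ of $(\mathbb{F}_{q^m})^n$, and $\pi_{q^m}$ is a group homomorphism. Let $F=(F_1,F_2,F_3)\in\operatorname{GA}_3(\mathbb{F}_q)$ fix one variable, that is, $F_i=X_i$ for some $i\in\{1,2,3\}$. Then $F$ is tamely mimickable: for every $m\ge 1$ there is $G_m\in\operatorname{TA}_3(\mathbb{F}_q)$ such that $\pi_{q^m}(G_m)=\pi_{q^m}(F)$. In other words, $\pi_{q^m}(F)\in\pi_{q^m}(\operatorname{TA}_3(\mathbb{F}_q))$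 for every single $m\ge 1$, so no single one of these bijections can show that $F$ is not tame. In particular, the Nagata automorphism $(X-2Y\Delta-Z\Delta^2,\;Y+Z\Delta,\;Z)$ with $\Delta=XZ+Y^2$ fixes a variable, and hence is tamely mimickable, over every finite field. -/

import Mathlib

universe v u

namespace PolyAut

/-- The group `GA_n(k)` of polynomial automorphisms of affine `n`-space over `k`.
A polynomial automorphism `F = (F_1, …, F_n)` is encoded by the `k`-algebra automorphism
`X_i ↦ F_i` of the polynomial ring. Passing to the opposite group makes the product of the group
the composition of polynomial maps, `(F * G)_i = F_i(G_1, …, G_n)` (see `comp_mul`). -/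
abbrev GA (n : ℕ) (k : Type*) [CommRing k] : Type _ :=
  (MvPolynomial (Fin n) k ≃ₐ[k] MvPolynomial (Fin n) k)ᵐᵒᵖ

section

variable {n : ℕ} {k : Type*} [CommRing k]

/-- The `i`-th component `F_i` of `F = (F_1, …, F_n)`. -/
noncomputable def comp (F : GA n k) (i : Fin n) : MvPolynomial (Fin n) k :=
  F.unop (MvPolynomial.X i)

theorem comp_one (i : Fin n) : comp (1 : GA n k) i = MvPolynomial.X i := rfl

theorem unop_apply (F : GA n k) (P : MvPolynomial (Fin n) k) :
    F.unop P = MvPolynomial.aeval (comp F) P := by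
  have h : (F.unop : MvPolynomial (Fin n) k →ₐ[k] MvPolynomial (Fin n) k)
      = MvPolynomial.aeval (comp F) := by
    ext i : 1
    simp [comp]
  exact DFunLike.congr_fun h P

/-- The group law is composition of polynomial maps. -/
theorem comp_mul (F G : GA n k) (i : Fin n) :
    comp (F * G) i = MvPolynomial.aeval (comp G) (comp F i) := by
  rw [← unop_apply]
  rfl

theorem ext_comp {F G : GA n k} (h : ∀ i, comp F i = comp G i) : F = G := by
  apply MulOpposite.unop_injective
  apply AlgEquiv.ext
  intro P
  rw [unop_apply, unop_apply, funext h]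

/-- The self-map of `L^n` given by `F`, for a commutative `k`-algebra `L`:
`x ↦ (F_1(x), …, F_n(x))`. -/
noncomputable def evalMap (L : Type*) [CommRing L] [Algebra k L] (F : GA n k)
    (x : Fin n → L) : Fin n → L :=
  fun i => MvPolynomial.aeval x (comp F i)

theorem evalMap_one (L : Type*) [CommRing L] [Algebra k L] (x : Fin n → L) :
    evalMap L (1 : GA n k) x = x := by
  funext i
  simp [evalMap, comp_one]

theorem evalMap_mul (L : Type*) [CommRing L] [Algebra k L] (F G : GA n k) (x : Fin n → L) :
    evalMap L (F * G) x = evalMap L F (evalMap L G x) := by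
  funext i
  have h : (MvPolynomial.aeval x : MvPolynomial (Fin n) k →ₐ[k] L).comp
      (MvPolynomial.aeval (comp G)) = MvPolynomial.aeval (evalMap L G x) := by
    ext j : 1
    simp [evalMap]
  have h2 := DFunLike.congr_fun h (comp F i)
  simpa [evalMap, comp_mul] using h2

/-- The homomorphism from `GA_n(k)` to the bijections of `L^n`, sending a polynomial automorphism
to the bijection `x ↦ (F_1(x), …, F_n(x))` which it induces. For `k = 𝔽_q` and `L = 𝔽_{q^m}` this
is the map `π_{q^m}`. -/
noncomputable def inducedPerm (n : ℕ) (k : Type*) [CommRing k] (L : Type*) [CommRing L]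
    [Algebra k L] : GA n k →* Equiv.Perm (Fin n → L) where
  toFun F :=
    { toFun := evalMap L F
      invFun := evalMap L F⁻¹
      left_inv := fun x => by rw [← evalMap_mul, inv_mul_cancel, evalMap_one]
      right_inv := fun x => by rw [← evalMap_mul, mul_inv_cancel, evalMap_one] }
  map_one' := by
    ext1 x
    exact evalMap_one L x
  map_mul' F G := by
    ext1 x
    exact evalMap_mul L F G x

/-- `F` is affine: every component has degree at most one. -/
def IsAffine (F : GA n k) : Prop :=
  ∀ i, (comp F i).totalDegree ≤ 1

/-- `F` is one of the elementary automorphisms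
`E_{i,α} = (X_1, …, X_{i-1}, X_i + X^α, X_{i+1}, …, X_n)`, where the monomial `X^α` does not
involve `X_i`. -/
def IsElementary (F : GA n k) : Prop :=
  ∃ (i : Fin n) (α : Fin n →₀ ℕ), α i = 0 ∧
    comp F i = MvPolynomial.X i + MvPolynomial.monomial α 1 ∧
    ∀ j, j ≠ i → comp F j = MvPolynomial.X j

/-- `F` fixes one of the variables: `F_i = X_i` for some `i`. -/
def FixesVariable (F : GA n k) : Prop :=
  ∃ i, comp F i = MvPolynomial.X i

end

/-- The tame subgroup `TA_n(k)`, generated by the affine and the elementary automorphisms. -/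
noncomputable def TA (n : ℕ) (k : Type*) [CommRing k] : Subgroup (GA n k) :=
  Subgroup.closure ({F | IsAffine F} ∪ {F | IsElementary F})

/-- `F ∈ GA_n(𝔽_q)` is `H`-mimickable: for every `m ≥ 1` there is `G_m ∈ H` inducing the same
bijection of `(𝔽_{q^m})^n` as `F`. Here `k = 𝔽_q`, and `L` is any model of the extension
`𝔽_{q^m}` of `k`; the element `G_m` depends on `m` only, not on the model. -/
def IsMimickable {n : ℕ} {k : Type u} [Field k] (H : Subgroup (GA n k)) (F : GA n k) :
    Prop :=
  ∀ m : ℕ, 0 < m → ∃ G ∈ H, ∀ (L : Type v) [Field L] [Algebra k L],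
    Nat.card L = Nat.card k ^ m → inducedPerm n k L F = inducedPerm n k L G

section Nagata

open MvPolynomial

/-- The polynomial `Δ = XZ + Y²`, in the variables `X = X 0`, `Y = X 1`, `Z = X 2`. -/
noncomputable def nagataDelta (k : Type*) [CommRing k] : MvPolynomial (Fin 3) k :=
  X 0 * X 2 + X 1 ^ 2

/-- The Nagata automorphism `(X - 2YΔ - ZΔ², Y + ZΔ, Z)` of `k³`, where `Δ = XZ + Y²`. -/
noncomputable def nagata (k : Type*) [CommRing k] : GA 3 k :=
  MulOpposite.op <| AlgEquiv.ofAlgHom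
    (aeval ![X 0 - 2 * X 1 * nagataDelta k - X 2 * nagataDelta k ^ 2,
      X 1 + X 2 * nagataDelta k, X 2])
    (aeval ![X 0 + 2 * X 1 * nagataDelta k - X 2 * nagataDelta k ^ 2,
      X 1 - X 2 * nagataDelta k, X 2])
    (by
      ext i : 1
      fin_cases i <;> simp [nagataDelta, two_mul] <;> ring)
    (by
      ext i : 1
      fin_cases i <;> simp [nagataDelta, two_mul] <;> ring)

theorem comp_nagata (k : Type*) [CommRing k] :
    comp (nagata k) = ![X 0 - 2 * X 1 * nagataDelta k - X 2 * nagataDelta k ^ 2,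
      X 1 + X 2 * nagataDelta k, X 2] := by
  funext i
  simp [comp, nagata]

end Nagata

end PolyAut

/-!
Suppose that `F` fixes the last variable `Z`; a permutation of the variables, which is affine,
reduces to this case. For a point with last coordinate `z` in an extension `L` of `k`, the map `F`
acts on the first two coordinates by a plane automorphism `F_z` over the residue field `κ =
k[Z]/(P)`, where `P` is the minimal polynomial of `z`. If `L` has `q ^ m` elements, then `P` is
one of the irreducible factors of `Z ^ (q ^ m) - Z`, so only finitely many `P` occur.

The Jacobian determinant of `F` is a constant `c` in `k`, independent of `z`, so a global scaling
makes all `F_z` have determinant one. By the theorem of Jung and van der Kulk, `F_z` is then a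
product of elementary automorphisms over `κ` (`plane_induction`). By the Chinese remainder theorem
each of their coefficients lifts to an element of `k[Z]` which vanishes modulo the other factors
of `Z ^ (q ^ m) - Z`. This gives a tame automorphism over `k` that acts as `F` over the zeros of
`P` and trivially over the zeros of the other factors (`exists_tame_of_irreducible`); the product
over all `P` induces the same permutation as `F` (`exists_tame_of_finset`).

The theorem of Jung and van der Kulk is needed in positive characteristic, where arguments that
differentiate a polynomial relation between leading terms break down. The proof here uses the
degree in `Y` on the field `K(X, Y)`. It rests on the estimate
`IsDegreeValuation.le_map_laurentEval` for the degree of a polynomial in `f` and `g` when the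
leading terms of `f` and `g` are dependent. One passes to monomials `S, u` in `f, g` with `deg u =
0`, subtracts from `u` its constant leading term `c`, and repeats this with the pair `S, u - c`.
Up to sign the 2-form `d log S ∧ d log u` equals `d log f ∧ d log g`, and the degree of `d log S ∧
d log (u - c)` exceeds it by the drop of degree from `u` to `u - c`. As the degree of such a form
is at most `-1`, all the drops together are at most `deg f + deg g - 1`. This is too small for a
polynomial in `f` and `g` to be equal to `X`, which has degree zero, unless one of the degrees of
`f` and `g` divides the other, and then an elementary automorphism lowers a degree
(`exists_reduction`).
-/

/-! ### Degrees of Laurent polynomials in two dependent elements -/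

namespace PolyAut

open Polynomial WithZero

/-- The Jacobian bracket `D₁ a * D₂ b - D₁ b * D₂ a` of two derivations. -/
def jac {R A : Type*} [CommRing R] [CommRing A] [Algebra R A] (D₁ D₂ : Derivation R A A)
    (a b : A) : A :=
  D₁ a * D₂ b - D₁ b * D₂ a

/-- A degree function on a field `E` over `K`, written as a valuation, together with two
derivations whose Jacobian bracket lowers the degree, and such that `K` is algebraically closed in
the residue field. -/
structure IsDegreeValuation {K E : Type*} [Field K] [Field E] [Algebra K E]
    (v : Valuation E ℤᵐ⁰) (D₁ D₂ : Derivation K E E) : Prop where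
  map_const : ∀ c : K, c ≠ 0 → v (algebraMap K E c) = 1
  map_jac_le : ∀ a b, v (jac D₁ D₂ a b) ≤ v a * v b * exp (-1)
  residue : ∀ u, v u = 1 → (∃ c : K, v (u - algebraMap K E c) < 1) ∨
    ∀ h : K[X], h ≠ 0 → v (aeval u h) = 1

section

variable {K E : Type*} [Field K] [Field E] [Algebra K E]

/-- The value at `(s, t)` of the Laurent polynomial with support in `I` and coefficients `G`. -/
def laurentEval (I : Finset (ℤ × ℤ)) (G : ℤ × ℤ → K) (s t : E) : E :=
  ∑ p ∈ I, algebraMap K E (G p) * (s ^ p.1 * t ^ p.2)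

theorem derivation_zpow_mul_zpow (D : Derivation K E E) {s t : E} (hs : s ≠ 0) (ht : t ≠ 0)
    (x y : ℤ) :
    D (s ^ x * t ^ y) = s ^ x * t ^ y * (x * (D s / s) + y * (D t / t)) := by
  rw [Derivation.leibniz, Derivation.leibniz_zpow, Derivation.leibniz_zpow]
  simp only [zsmul_eq_mul, smul_eq_mul, zpow_sub_one₀ hs, zpow_sub_one₀ ht]
  field_simp
  ring

/-- The logarithmic bracket `jac s t / (s * t)` only changes by a determinant under a monomial
change of variables. -/
theorem jac_zpow_mul_zpow (D₁ D₂ : Derivation K E E) {s t : E} (hs : s ≠ 0) (ht : t ≠ 0)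
    (x y z w : ℤ) :
    jac D₁ D₂ (s ^ x * t ^ y) (s ^ z * t ^ w) =
      ((x * w - y * z : ℤ) : E) * ((s ^ x * t ^ y) * (s ^ z * t ^ w)) *
        (jac D₁ D₂ s t / (s * t)) := by
  simp only [jac, derivation_zpow_mul_zpow _ hs ht]
  push_cast
  field_simp
  ring

theorem jac_sub_const (D₁ D₂ : Derivation K E E) (s t : E) (c : K) :
    jac D₁ D₂ s (t - algebraMap K E c) = jac D₁ D₂ s t := by
  simp [jac]

/-- After a unimodular monomial change of variables `S = s ^ x * t ^ y`, `u = s ^ (-b) * t ^ a`,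
a Laurent polynomial in `s, t` is, up to a power of `u`, a Laurent polynomial in `S` whose
coefficients are polynomials in `u`. -/
theorem exists_rows {s t : E} (hs : s ≠ 0) (ht : t ≠ 0) {a b x y : ℤ} (hab : x * a + y * b = 1)
    (I : Finset (ℤ × ℤ)) (G : ℤ × ℤ → K) :
    ∃ (B : ℕ) (S : Finset ℤ) (h : ℤ → K[X]),
      (s ^ (-b) * t ^ a) ^ B * laurentEval I G s t =
        ∑ N ∈ S, (s ^ x * t ^ y) ^ N * aeval (s ^ (-b) * t ^ a) (h N) ∧
      (∀ N n, (h N).coeff n ≠ 0 → ∃ p ∈ I, G p ≠ 0 ∧ a * p.1 + b * p.2 = N ∧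
        x * p.2 - y * p.1 + B = n) ∧
      ∀ p ∈ I, G p ≠ 0 → a * p.1 + b * p.2 ∈ S ∧ h (a * p.1 + b * p.2) ≠ 0 := by
  classical
  obtain ⟨B, hB⟩ : ∃ B : ℕ, ∀ p ∈ I, 0 ≤ x * p.2 - y * p.1 + B := by
    refine ⟨∑ p ∈ I, (x * p.2 - y * p.1).natAbs, fun p hp => ?_⟩
    have := Finset.single_le_sum (f := fun p : ℤ × ℤ => (x * p.2 - y * p.1).natAbs)
      (fun _ _ => Nat.zero_le _) hp
    omega
  have hu : s ^ (-b) * t ^ a ≠ 0 := mul_ne_zero (zpow_ne_zero _ hs) (zpow_ne_zero _ ht)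
  set N : ℤ × ℤ → ℤ := fun p => a * p.1 + b * p.2 with hN
  set l : ℤ × ℤ → ℕ := fun p => (x * p.2 - y * p.1 + B).toNat with hl
  have hl' : ∀ p ∈ I, ((l p : ℕ) : ℤ) = x * p.2 - y * p.1 + B := fun p hp =>
    Int.toNat_of_nonneg (hB p hp)
  set h : ℤ → K[X] := fun n => ∑ p ∈ I with N p = n, monomial (l p) (G p) with hh
  have inj : ∀ p ∈ I, ∀ p' ∈ I, N p = N p' → l p = l p' → p = p' := by
    intro p hp p' hp' h1 h2
    have h3 : x * p.2 - y * p.1 = x * p'.2 - y * p'.1 := by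
      have := hl' p hp; have := hl' p' hp'; omega
    simp only [hN] at h1
    ext
    · linear_combination x * h1 - b * h3 - (p.1 - p'.1) * hab
    · linear_combination y * h1 + a * h3 - (p.2 - p'.2) * hab
  have hcoeff : ∀ p ∈ I, (h (N p)).coeff (l p) = G p := by
    intro p hp
    simp only [hh, finsetSum_coeff, coeff_monomial]
    rw [Finset.sum_eq_single_of_mem p (by simp [hp])]
    · simp
    · intro p' hp' hne
      rw [if_neg]
      intro h1
      simp only [Finset.mem_filter] at hp'
      exact hne (inj p' hp'.1 p hp hp'.2 h1)
  refine ⟨B, I.image N, h, ?_, ?_, ?_⟩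
  · rw [laurentEval, Finset.mul_sum, ← Finset.sum_fiberwise_of_maps_to (g := N) (t := I.image N)
      (fun p hp => Finset.mem_image_of_mem N hp)]
    refine Finset.sum_congr rfl fun n _ => ?_
    simp only [hh, map_sum, Finset.mul_sum, aeval_monomial]
    refine Finset.sum_congr rfl fun p hp => ?_
    simp only [Finset.mem_filter] at hp
    have mono : s ^ p.1 * t ^ p.2 =
        (s ^ x * t ^ y) ^ n * (s ^ (-b) * t ^ a) ^ (x * p.2 - y * p.1) := by
      simp only [mul_zpow, ← zpow_mul]
      rw [mul_mul_mul_comm, ← zpow_add₀ hs, ← zpow_add₀ ht, ← hp.2]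
      congr 2
      · simp only [hN]; linear_combination - p.1 * hab
      · simp only [hN]; linear_combination - p.2 * hab
    have key : (s ^ (-b) * t ^ a) ^ B * (s ^ p.1 * t ^ p.2) =
        (s ^ x * t ^ y) ^ n * (s ^ (-b) * t ^ a) ^ l p := by
      rw [mono, ← zpow_natCast _ (l p), hl' p hp.1, zpow_add₀ hu, zpow_natCast]
      ring
    rw [mul_left_comm, key]; ring
  · intro n j hj
    simp only [hh, finsetSum_coeff, coeff_monomial] at hj
    obtain ⟨p, hp, hp'⟩ := Finset.exists_ne_zero_of_sum_ne_zero hj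
    simp only [Finset.mem_filter] at hp
    split_ifs at hp' with h1
    · exact ⟨p, hp.1, hp', hp.2, by rw [← hl' p hp.1, h1]⟩
    · exact absurd rfl hp'
  · intro p hp hG
    refine ⟨Finset.mem_image_of_mem N hp, fun h0 => hG ?_⟩
    rw [← hcoeff p hp]
    simp only [hN] at h0 ⊢
    rw [h0, coeff_zero]

/-- If `u` has transcendental residue, there is no cancellation of leading terms. -/
theorem map_sum_of_transcendental {v : Valuation E ℤᵐ⁰} {s u : E} {e : ℤ} (he : 0 < e)
    (hs : v s = exp e) (hu : ∀ h : K[X], h ≠ 0 → v (aeval u h) = 1)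
    (S : Finset ℤ) (h : ℤ → K[X]) {N₀ : ℤ} (hN₀ : N₀ ∈ S) (h0 : h N₀ ≠ 0)
    (hmax : ∀ N, h N ≠ 0 → N ≤ N₀) :
    v (∑ N ∈ S, s ^ N * aeval u (h N)) = exp (e * N₀) := by
  classical
  have hterm : ∀ N, h N ≠ 0 → v (s ^ N * aeval u (h N)) = exp (e * N) := by
    intro N hN
    rw [map_mul, hu _ hN, mul_one, map_zpow₀, hs, ← exp_zsmul, smul_eq_mul, mul_comm]
  rw [Valuation.map_sum_eq_of_lt v hN₀, hterm _ h0]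
  · intro N hN
    simp only [Finset.mem_sdiff, Finset.mem_singleton] at hN
    rw [hterm _ h0]
    by_cases hN0 : h N = 0
    · simp [hN0]
    · rw [hterm _ hN0, exp_lt_exp]
      have := hmax N hN0
      have : N < N₀ := lt_of_le_of_ne this hN.2
      nlinarith

/-- A polynomial with support of length `k` vanishes to order at most `k` at `c ≠ 0`. -/
theorem exists_taylor_coeff_ne_zero {h : K[X]} (h0 : h ≠ 0) {c : K} (hc : c ≠ 0) {k : ℕ}
    (hk : ∀ i j, h.coeff i ≠ 0 → h.coeff j ≠ 0 → j ≤ i + k) :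
    ∃ r ≤ k, (taylor c h).coeff r ≠ 0 := by
  by_contra! hcon
  have h1 : X ^ (k + 1) ∣ taylor c h :=
    X_pow_dvd_iff.2 fun d hd => hcon d (by omega)
  have h2 : (X - C c) ^ (k + 1) ∣ h := by
    obtain ⟨w, hw⟩ := h1
    have := congrArg (taylor (-c)) hw
    rw [taylor_taylor, neg_add_cancel, taylor_zero, taylor_mul, taylor_pow, taylor_X] at this
    rw [this, C_neg, ← sub_eq_add_neg]
    exact dvd_mul_right _ _
  obtain ⟨w, hw⟩ : X ^ h.natTrailingDegree ∣ h := X_pow_dvd_iff.2 fun d hd =>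
    coeff_eq_zero_of_lt_natTrailingDegree hd
  have hcop : IsCoprime ((X - C c) ^ (k + 1)) (X ^ h.natTrailingDegree) := by
    apply IsCoprime.pow
    have := isCoprime_X_sub_C_of_isUnit_sub (a := c) (b := 0) (by simpa using hc)
    simpa using this
  have h3 : (X - C c) ^ (k + 1) ∣ w := hcop.dvd_of_dvd_mul_left (hw ▸ h2)
  have hw0 : w ≠ 0 := by rintro rfl; simp at hw; exact h0 hw
  have h4 := natDegree_le_of_dvd h3 hw0
  rw [natDegree_pow, natDegree_X_sub_C, mul_one] at h4
  have h5 : h.natDegree = h.natTrailingDegree + w.natDegree := by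
    conv_lhs => rw [hw]
    rw [natDegree_mul (by simp) hw0, natDegree_X_pow]
  have h6 := hk h.natTrailingDegree h.natDegree
    (by simpa [← trailingCoeff.eq_1] using h0) (by simpa using h0)
  omega


/-- If `u = s ^ (-b) * t ^ a` has transcendental residue, the degree of a Laurent polynomial in
`s, t` is its weighted degree. -/
theorem map_laurentEval_of_transcendental {v : Valuation E ℤᵐ⁰} {s t : E} {e a b x y : ℤ}
    (he : 0 < e) (hab : x * a + y * b = 1) (hs : v s = exp (e * a)) (ht : v t = exp (e * b))
    (hu : ∀ h : K[X], h ≠ 0 → v (aeval (s ^ (-b) * t ^ a) h) = 1)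
    {I : Finset (ℤ × ℤ)} {G : ℤ × ℤ → K} {μ : ℤ}
    (hex : ∃ p ∈ I, G p ≠ 0 ∧ a * p.1 + b * p.2 = μ)
    (hmax : ∀ p ∈ I, G p ≠ 0 → a * p.1 + b * p.2 ≤ μ) :
    v (laurentEval I G s t) = exp (e * μ) := by
  have hs0 : s ≠ 0 := (Valuation.ne_zero_iff v).1 (by rw [hs]; exact exp_ne_zero)
  have ht0 : t ≠ 0 := (Valuation.ne_zero_iff v).1 (by rw [ht]; exact exp_ne_zero)
  obtain ⟨B, S, h, hsum, hcoeff, hmem⟩ := exists_rows hs0 ht0 hab I G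
  have vs' : v (s ^ x * t ^ y) = exp e := by
    rw [map_mul, map_zpow₀, map_zpow₀, hs, ht, ← exp_zsmul, ← exp_zsmul, ← exp_add]
    congr 1; simp only [smul_eq_mul]; linear_combination e * hab
  have vu : v (s ^ (-b) * t ^ a) = 1 := by simpa using hu X X_ne_zero
  have hval : v (laurentEval I G s t) =
      v ((s ^ (-b) * t ^ a) ^ B * laurentEval I G s t) := by
    rw [map_mul, map_pow, vu, one_pow, one_mul]
  have hμS : μ ∈ S ∧ h μ ≠ 0 := by
    obtain ⟨p, hp, hG, rfl⟩ := hex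
    exact hmem p hp hG
  rw [hval, hsum, map_sum_of_transcendental he vs' hu S h hμS.1 hμS.2]
  intro N hN
  obtain ⟨n, hn⟩ : ∃ n, (h N).coeff n ≠ 0 := by
    by_contra! hcon
    exact hN (Polynomial.ext hcon)
  obtain ⟨p, hp, hG, rfl, -⟩ := hcoeff N n hn
  exact hmax p hp hG

/-- Lower bound for the degree of a Laurent polynomial in `s, t`. Here `s, t` have degrees `e * a`
and `e * b`, with `a, b` coprime, `μ` is the weighted degree of the Laurent polynomial, and its
top-degree part has at most `k + 1` terms. Cancellation can only lower the degree by `Λ * k`, where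
`Λ` measures how far the bracket of `s` and `t` is from the largest degree it could have.

If the leading term of `u = s ^ (-b) * t ^ a` is a constant `c`, one passes to the pair
`(s ^ x * t ^ y, u - c)`, for which the value of `Λ` is smaller by the drop in degree. -/
theorem IsDegreeValuation.le_map_laurentEval {v : Valuation E ℤᵐ⁰} {D₁ D₂ : Derivation K E E}
    (hv : IsDegreeValuation v D₁ D₂) (Λ : ℕ) :
    ∀ {s t : E} {e a b x y : ℤ}, 0 < e → x * a + y * b = 1 →
      v s = exp (e * a) → v t = exp (e * b) →
      v (jac D₁ D₂ s t) = exp (e * a + e * b - 1 - Λ) →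
      ∀ {I : Finset (ℤ × ℤ)} {G : ℤ × ℤ → K} {μ : ℤ} {k : ℕ},
      (∃ p ∈ I, G p ≠ 0 ∧ a * p.1 + b * p.2 = μ) →
      (∀ p ∈ I, G p ≠ 0 → a * p.1 + b * p.2 ≤ μ) →
      (∀ p ∈ I, ∀ p' ∈ I, G p ≠ 0 → G p' ≠ 0 → a * p.1 + b * p.2 = μ →
        ∀ l : ℤ, p'.1 = p.1 - l * b → p'.2 = p.2 + l * a → l ≤ k) →
      exp (e * μ - Λ * k) ≤ v (laurentEval I G s t) := by
  classical
  induction Λ using Nat.strong_induction_on with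
  | _ Λ ih =>
  intro s t e a b x y he hab hs ht hj I G μ k hex hmax hk
  have hs0 : s ≠ 0 := (Valuation.ne_zero_iff v).1 (by rw [hs]; exact exp_ne_zero)
  have ht0 : t ≠ 0 := (Valuation.ne_zero_iff v).1 (by rw [ht]; exact exp_ne_zero)
  obtain ⟨B, S, h, hsum, hcoeff, hmem⟩ := exists_rows hs0 ht0 hab I G
  set s' := s ^ x * t ^ y with hs'
  set u := s ^ (-b) * t ^ a with hu
  have vs' : v s' = exp e := by
    rw [hs', map_mul, map_zpow₀, map_zpow₀, hs, ht, ← exp_zsmul, ← exp_zsmul, ← exp_add]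
    congr 1; simp only [smul_eq_mul]; linear_combination e * hab
  have vu : v u = 1 := by
    rw [hu, map_mul, map_zpow₀, map_zpow₀, hs, ht, ← exp_zsmul, ← exp_zsmul, ← exp_add,
      ← exp_zero]
    congr 1; simp only [smul_eq_mul]; ring
  have hj' : v (jac D₁ D₂ s' u) = exp (e - 1 - Λ) := by
    have hdet : x * a - y * -b = 1 := by linear_combination hab
    rw [hs', hu, jac_zpow_mul_zpow D₁ D₂ hs0 ht0, ← hs', ← hu, hdet, Int.cast_one, one_mul,
      map_mul v (s' * u), map_mul v s' u, map_div₀, map_mul v s t, hj, hs, ht, vs', vu, mul_one,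
      ← exp_add, ← exp_sub, ← exp_add]
    congr 1; ring
  have hval : v (laurentEval I G s t) = v (∑ N ∈ S, s' ^ N * aeval u (h N)) := by
    rw [← hsum, map_mul, map_pow, vu, one_pow, one_mul]
  have hμS : μ ∈ S ∧ h μ ≠ 0 := by
    obtain ⟨p, hp, hG, rfl⟩ := hex
    exact hmem p hp hG
  rcases hv.residue u vu with ⟨c, hc⟩ | htr
  swap
  · rw [map_laurentEval_of_transcendental he hab hs ht htr hex hmax, exp_le_exp]
    have : (0 : ℤ) ≤ Λ * k := by positivity
    linarith
  have htop : ∀ N, h N ≠ 0 → N ≤ μ := by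
    intro N hN
    obtain ⟨n, hn⟩ : ∃ n, (h N).coeff n ≠ 0 := by
      by_contra! hcon
      exact hN (Polynomial.ext hcon)
    obtain ⟨p, hp, hG, rfl, -⟩ := hcoeff N n hn
    exact hmax p hp hG
  rw [hval]
  have hc0 : c ≠ 0 := by
    rintro rfl
    rw [map_zero, sub_zero, vu] at hc
    exact lt_irrefl _ hc
  set t' := u - algebraMap K E c with ht'
  have hjt : v (jac D₁ D₂ s' t') = exp (e - 1 - Λ) := by
    rw [ht', jac_sub_const, hj']
  have ht'0 : t' ≠ 0 := by
    intro h0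
    simp only [h0, jac, map_zero, mul_zero, zero_mul, sub_zero] at hjt
    exact exp_ne_zero hjt.symm
  obtain ⟨δ, hδ⟩ : ∃ δ : ℤ, v t' = exp (-δ) :=
    ⟨-log (v t'), by rw [neg_neg, exp_log ((Valuation.ne_zero_iff v).2 ht'0)]⟩
  have hδ1 : 0 < δ := by
    rw [hδ, ← exp_zero, exp_lt_exp] at hc
    omega
  have hδΛ : δ ≤ Λ := by
    have := hv.map_jac_le s' t'
    rw [hjt, vs', hδ, ← exp_add, ← exp_add, exp_le_exp] at this
    omega
  -- The top row vanishes at `c` to some order `r` which is at most `k`.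
  obtain ⟨r, hrk, hr⟩ : ∃ r ≤ k, (taylor c (h μ)).coeff r ≠ 0 := by
    refine exists_taylor_coeff_ne_zero hμS.2 hc0 fun i j hi hj => ?_
    obtain ⟨p, hp, hG, hpN, hpl⟩ := hcoeff μ i hi
    obtain ⟨p', hp', hG', hpN', hpl'⟩ := hcoeff μ j hj
    have := hk p hp p' hp' hG hG' hpN (j - i)
      (by linear_combination x * (hpN' - hpN) - b * (hpl' - hpl) - (p'.1 - p.1) * hab)
      (by linear_combination y * (hpN' - hpN) + a * (hpl' - hpl) - (p'.2 - p.2) * hab)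
    omega
  obtain ⟨d, hd⟩ : ∃ d : ℕ, ∀ N ∈ S, (taylor c (h N)).natDegree < d := by
    refine ⟨∑ N ∈ S, (taylor c (h N)).natDegree + 1, fun N hN => ?_⟩
    have := Finset.single_le_sum (f := fun N => (taylor c (h N)).natDegree)
      (fun _ _ => Nat.zero_le _) hN
    omega
  set I' : Finset (ℤ × ℤ) := S ×ˢ (Finset.range d).image (Nat.cast : ℕ → ℤ) with hI'
  set G' : ℤ × ℤ → K := fun p => (taylor c (h p.1)).coeff p.2.toNat with hG'
  have hsum' : ∑ N ∈ S, s' ^ N * aeval u (h N) = laurentEval I' G' s' t' := by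
    rw [laurentEval, hI', Finset.sum_product]
    refine Finset.sum_congr rfl fun N hN => ?_
    rw [Finset.sum_image (fun _ _ _ _ h => by exact_mod_cast h)]
    have h1 : aeval u (h N) = aeval t' (taylor c (h N)) := by
      rw [taylor_apply, aeval_comp]
      simp [ht']
    rw [h1, aeval_eq_sum_range' (hd N hN), Finset.mul_sum]
    refine Finset.sum_congr rfl fun j _ => ?_
    simp only [hG', Int.toNat_natCast, zpow_natCast, Algebra.smul_def]
    ring
  -- Degrees of `s'` and `t'`, with their greatest common divisor taken out.
  obtain ⟨g, a', b', x', y', hg, ha', hb', hab'⟩ : ∃ g a' b' x' y' : ℤ, 0 < g ∧ e = g * a' ∧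
      -δ = g * b' ∧ x' * a' + y' * b' = 1 := by
    have hpos : 0 < Int.gcd e (-δ) := Int.gcd_pos_of_ne_zero_left _ he.ne'
    obtain ⟨a', ha'⟩ := Int.gcd_dvd_left e (-δ)
    obtain ⟨b', hb'⟩ := Int.gcd_dvd_right e (-δ)
    refine ⟨Int.gcd e (-δ), a', b', Int.gcdA e (-δ), Int.gcdB e (-δ), by exact_mod_cast hpos,
      ha', hb', ?_⟩
    have := Int.gcd_eq_gcd_ab e (-δ)
    have hne : ((Int.gcd e (-δ) : ℕ) : ℤ) ≠ 0 := by exact_mod_cast hpos.ne'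
    apply mul_left_cancel₀ hne
    linear_combination -this - (Int.gcdA e (-δ)) * ha' - (Int.gcdB e (-δ)) * hb'
  have ha'1 : 0 < a' := by
    by_contra! hcon
    nlinarith
  have hb'1 : b' < 0 := by
    by_contra! hcon
    nlinarith
  have hrI : (μ, (r : ℤ)) ∈ I' := by
    have : r < d := by
      have h1 := hd μ hμS.1
      have h2 := le_natDegree_of_ne_zero hr
      omega
    simp [hI', hμS.1, this]
  have hrG : G' (μ, (r : ℤ)) ≠ 0 := by simpa [hG'] using hr
  have hG'top : ∀ p ∈ I', G' p ≠ 0 → p.1 ≤ μ ∧ 0 ≤ p.2 := by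
    intro p hp hGp
    refine ⟨htop _ fun h0 => hGp ?_, ?_⟩
    · simp [hG', h0]
    · simp only [hI', Finset.mem_product, Finset.mem_image] at hp
      obtain ⟨n, -, hn⟩ := hp.2
      omega
  obtain ⟨p₀, hp₀, hp₀max⟩ := Finset.exists_max_image (I'.filter fun p => G' p ≠ 0)
    (fun p => a' * p.1 + b' * p.2) ⟨(μ, (r : ℤ)), Finset.mem_filter.2 ⟨hrI, hrG⟩⟩
  simp only [Finset.mem_filter] at hp₀ hp₀max
  have hμ' := hp₀max _ ⟨hrI, hrG⟩
  simp only at hμ'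
  have main := ih (Λ - δ.toNat) (by omega) (s := s') (t := t') (e := g) (a := a') (b := b')
    (I := I') (G := G') (k := r) hg hab'
    (by rw [vs', ha']) (by rw [hδ, hb'])
    (by rw [hjt, ← ha', ← hb']; congr 1; omega) ⟨p₀, hp₀.1, hp₀.2, rfl⟩
    (fun p hp hGp => hp₀max p ⟨hp, hGp⟩)
    (by
      intro p hp p' hp' hGp hGp' hpμ l hl1 hl2
      have h1 := hG'top p hp hGp
      have h2 := hG'top p' hp' hGp'
      -- Points on the top line have `0 ≤ p.2 ≤ r`.
      have h3 : p'.2 ≤ r := by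
        have h4 : a' * p'.1 + b' * p'.2 = a' * p₀.1 + b' * p₀.2 := by
          rw [hl1, hl2]; linear_combination hpμ
        nlinarith
      by_contra! hlr
      nlinarith)
  rw [hsum']
  refine le_trans ?_ main
  rw [exp_le_exp]
  have h5 : ((Λ - δ.toNat : ℕ) : ℤ) = Λ - δ := by omega
  rw [h5]
  have h6 : (r : ℤ) ≤ k := by exact_mod_cast hrk
  have h7 : g * (a' * μ + b' * r) = e * μ - δ * r := by rw [ha']; linear_combination - r * hb'
  have h8 : g * (a' * μ + b' * r) ≤ g * (a' * p₀.1 + b' * p₀.2) :=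
    mul_le_mul_of_nonneg_left hμ' hg.le
  have h9 : (Λ : ℤ) * r ≤ Λ * k := mul_le_mul_of_nonneg_left h6 (by positivity)
  linarith

end

end PolyAut

/-! ### The degree in `Y` on the field of bivariate rational functions -/

namespace PolyAut

open Polynomial WithZero

open scoped Polynomial.Bivariate

section FractionField

theorem exists_derivation_extension {K A E : Type*} [CommRing K] [CommRing A] [IsDomain A]
    [Field E] [Algebra K A] [Algebra A E] [Algebra K E] [IsScalarTower K A E] [IsFractionRing A E]
    (D : Derivation K A A) :
    ∃ D' : Derivation K E E, ∀ a, D' (algebraMap A E a) = algebraMap A E (D a) := by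
  -- A derivation is the same as a section of the dual numbers, and sections extend to fractions.
  let φ : A →ₐ[K] TrivSqZeroExt E E := AlgHom.ofLinearMap
    { toFun := fun a => TrivSqZeroExt.inl (algebraMap A E a) +
        TrivSqZeroExt.inr (algebraMap A E (D a))
      map_add' := fun a b => by
        ext
        · simp
        · simp only [map_add, TrivSqZeroExt.snd_add, TrivSqZeroExt.snd_inl,
            TrivSqZeroExt.snd_inr, zero_add]
      map_smul' := fun c a => by
        have h : ∀ x, algebraMap A E (c • x) = c • algebraMap A E x := fun x =>
          (Algebra.linearMap A E).map_smul_of_tower c x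
        ext
        · simp only [TrivSqZeroExt.fst_add, TrivSqZeroExt.fst_inl, TrivSqZeroExt.fst_inr,
            TrivSqZeroExt.fst_smul, RingHom.id_apply, h, add_zero]
        · simp only [Derivation.map_smul, TrivSqZeroExt.snd_add, TrivSqZeroExt.snd_inl,
            TrivSqZeroExt.snd_inr, TrivSqZeroExt.snd_smul, RingHom.id_apply, h, zero_add] }
    (by ext <;> simp)
    (fun a b => by
      ext
      · simp
      · simp only [Derivation.leibniz, TrivSqZeroExt.snd_add, TrivSqZeroExt.snd_inl,
          TrivSqZeroExt.snd_inr, zero_add, LinearMap.coe_mk, AddHom.coe_mk, smul_eq_mul, map_add,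
          map_mul, TrivSqZeroExt.snd_mul, TrivSqZeroExt.fst_add, TrivSqZeroExt.fst_inl,
          TrivSqZeroExt.fst_inr, add_zero, op_smul_eq_smul])
  have hφ : ∀ y : nonZeroDivisors A, IsUnit (φ y) := by
    intro y
    rw [TrivSqZeroExt.isUnit_iff_isUnit_fst]
    simp [φ]
  let ψ : E →ₐ[K] TrivSqZeroExt E E := IsLocalization.liftAlgHom (M := nonZeroDivisors A) hφ
  have hψ : ∀ a, ψ (algebraMap A E a) = φ a := fun a => by simp [ψ]
  have hfst : ∀ e, (ψ e).fst = e := by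
    intro e
    have : ((TrivSqZeroExt.fstHom E E E).toRingHom.comp ψ.toRingHom) = RingHom.id E := by
      apply IsLocalization.ringHom_ext (nonZeroDivisors A)
      ext a
      simp [hψ, φ]
    exact congrArg (fun f : E →+* E => f e) this
  refine ⟨Derivation.mk' ((TrivSqZeroExt.sndHom E E).restrictScalars K ∘ₗ ψ.toLinearMap) ?_, ?_⟩
  · intro a b
    change (ψ (a * b)).snd = a * (ψ b).snd + b * (ψ a).snd
    rw [map_mul, TrivSqZeroExt.snd_mul, hfst, hfst, op_smul_eq_smul, smul_eq_mul, smul_eq_mul]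
  · intro a
    change (ψ (algebraMap A E a)).snd = _
    rw [hψ]
    change (TrivSqZeroExt.inl (algebraMap A E a) +
      TrivSqZeroExt.inr (algebraMap A E (D a)) : TrivSqZeroExt E E).snd = _
    rw [TrivSqZeroExt.snd_add, TrivSqZeroExt.snd_inl, TrivSqZeroExt.snd_inr, zero_add]

theorem exists_degree_valuation (R E : Type*) [CommRing R] [IsDomain R] [Field E] [Algebra R[X] E]
    [IsFractionRing R[X] E] :
    ∃ v : Valuation E ℤᵐ⁰, ∀ a : R[X], a ≠ 0 → v (algebraMap R[X] E a) = exp (a.natDegree : ℤ) := by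
  classical
  let w : Valuation R[X] ℤᵐ⁰ :=
    { toFun := fun a => if a = 0 then 0 else exp (a.natDegree : ℤ)
      map_zero' := by simp
      map_one' := by simp
      map_mul' := fun a b => by
        by_cases ha : a = 0
        · simp [ha]
        by_cases hb : b = 0
        · simp [hb]
        simp only [ha, hb, mul_eq_zero, or_self, if_false]
        rw [natDegree_mul ha hb, ← exp_add, Nat.cast_add]
      map_add_le_max' := fun a b => by
        by_cases hab : a + b = 0
        · simp [hab]
        by_cases ha : a = 0
        · simp [ha]
        by_cases hb : b = 0
        · simp [hb]
        simp only [ha, hb, hab, if_false, le_max_iff, exp_le_exp, Nat.cast_le]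
        exact le_max_iff.1 (natDegree_add_le a b) }
  have hw : nonZeroDivisors R[X] ≤ w.supp.primeCompl := by
    intro a ha h0
    have : w a = 0 := h0
    have ha0 := nonZeroDivisors.ne_zero ha
    have h1 : w a = exp (a.natDegree : ℤ) := if_neg ha0
    rw [h1] at this
    exact exp_ne_zero this
  refine ⟨w.extendToLocalization hw E, fun a ha => ?_⟩
  rw [Valuation.extendToLocalization_apply_map_apply]
  exact if_neg ha

theorem map_derivation_le {K A E : Type*} [CommRing K] [CommRing A] [IsDomain A]
    [Field E] [Algebra K A] [Algebra A E] [Algebra K E] [IsFractionRing A E]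
    {v : Valuation E ℤᵐ⁰} {D : Derivation K E E} {γ : ℤᵐ⁰}
    (h : ∀ a : A, v (D (algebraMap A E a)) ≤ v (algebraMap A E a) * γ) (e : E) :
    v (D e) ≤ v e * γ := by
  obtain ⟨a, b, hb, rfl⟩ := IsFractionRing.div_surjective (A := A) e
  have hb0 : algebraMap A E b ≠ 0 := by
    simpa using nonZeroDivisors.ne_zero hb
  set e := algebraMap A E a / algebraMap A E b with he
  have h1 : algebraMap A E b * e = algebraMap A E a := by rw [he]; field_simp
  have h2 := congrArg D h1
  rw [Derivation.leibniz, smul_eq_mul, smul_eq_mul] at h2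
  have h3 : algebraMap A E b * D e = D (algebraMap A E a) - e * D (algebraMap A E b) := by
    rw [← h2]; ring
  have h4 : v (algebraMap A E b * D e) ≤ v (algebraMap A E b) * (v e * γ) := by
    rw [h3]
    apply Valuation.map_sub_le
    · refine (h a).trans (le_of_eq ?_)
      rw [← h1, map_mul, mul_assoc]
    · rw [map_mul, mul_left_comm]
      exact mul_le_mul_right (h b) _
  rw [map_mul] at h4
  exact le_of_mul_le_mul_left h4 ((Valuation.pos_iff v).2 hb0)

end FractionField

section Bivariate

variable {K : Type*} [Field K]

/-- The partial derivative of `K[X][Y]` with respect to the inner variable `X`. -/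
noncomputable def derivX (K : Type*) [CommRing K] : Derivation K K[X][Y] K[X][Y] :=
  ((PolynomialModule.equivPolynomialSelf (R := K[X])).toLinearMap).compDer
    (derivative' (R := K)).mapCoeffs

/-- The partial derivative of `K[X][Y]` with respect to the outer variable `Y`. -/
noncomputable def derivY (K : Type*) [CommRing K] : Derivation K K[X][Y] K[X][Y] :=
  (derivative' (R := K[X])).restrictScalars K

theorem derivY_apply (p : K[X][Y]) : derivY K p = derivative p := rfl

theorem coeff_derivX (p : K[X][Y]) (i : ℕ) : (derivX K p).coeff i = derivative (p.coeff i) := rfl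

theorem derivX_C (p : K[X]) : derivX K (C p) = C (derivative p) := by
  ext1 i
  rw [coeff_derivX, coeff_C, coeff_C]
  split_ifs <;> simp

theorem derivX_Y : derivX K (Y : K[X][Y]) = 0 := by
  ext1 i
  rw [coeff_derivX, coeff_X]
  split_ifs <;> simp

theorem residue_of_natDegree_valuation {E : Type*} [Field E] [Algebra K[X][Y] E]
    [IsFractionRing K[X][Y] E] [Algebra K E] [IsScalarTower K K[X][Y] E] {v : Valuation E ℤᵐ⁰}
    (hv : ∀ a : K[X][Y], a ≠ 0 → v (algebraMap _ E a) = exp (a.natDegree : ℤ)) (u : E)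
    (hu : v u = 1) :
    (∃ c : K, v (u - algebraMap K E c) < 1) ∨ ∀ h : K[X], h ≠ 0 → v (aeval u h) = 1 := by
  obtain ⟨a, b, hb, rfl⟩ := IsFractionRing.div_surjective (A := K[X][Y]) u
  have hb0 : b ≠ 0 := nonZeroDivisors.ne_zero hb
  have hbE : algebraMap K[X][Y] E b ≠ 0 := by simpa using hb0
  have ha0 : a ≠ 0 := by rintro rfl; simp at hu
  have hdeg : a.natDegree = b.natDegree := by
    rw [map_div₀, hv a ha0, hv b hb0, ← exp_sub, exp_eq_one] at hu
    omega
  have hvb : v (algebraMap K[X][Y] E b) ≠ 0 := by rw [hv b hb0]; exact exp_ne_zero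
  set d := b.natDegree with hd
  by_cases hc : ∃ c : K, a.leadingCoeff = C c * b.leadingCoeff
  · obtain ⟨c, hc⟩ := hc
    left
    refine ⟨c, ?_⟩
    have h1 : algebraMap K[X][Y] E a / algebraMap K[X][Y] E b - algebraMap K E c =
        algebraMap K[X][Y] E (a - C (C c) * b) / algebraMap K[X][Y] E b := by
      rw [map_sub, map_mul, IsScalarTower.algebraMap_apply K K[X][Y] E]
      field_simp
      rfl
    rw [h1, map_div₀]
    refine (div_lt_one₀ (zero_lt_iff.2 hvb)).2 ?_
    by_cases h0 : a - C (C c) * b = 0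
    · rw [h0, map_zero, map_zero]; exact zero_lt_iff.2 hvb
    have hc0 : C c ≠ (0 : K[X]) := by
      intro h; rw [h, zero_mul] at hc; exact ha0 (leadingCoeff_eq_zero.1 hc)
    rw [hv _ h0, hv _ hb0, exp_lt_exp, Nat.cast_lt, ← hd, ← hdeg]
    apply natDegree_lt_natDegree h0
    apply degree_sub_lt_left _ ha0
    · rw [leadingCoeff_mul, leadingCoeff_C, hc]
    · rw [degree_C_mul hc0, degree_eq_natDegree ha0, degree_eq_natDegree hb0, hdeg]
  · right
    intro h h0
    set α := a.leadingCoeff with hα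
    set β := b.leadingCoeff with hβ
    have hβ0 : β ≠ 0 := leadingCoeff_ne_zero.2 hb0
    have hβR : algebraMap K[X] (RatFunc K) β ≠ 0 := by simpa using hβ0
    have htr : aeval (algebraMap K[X] (RatFunc K) α / algebraMap K[X] (RatFunc K) β) h ≠ 0 := by
      intro hz
      refine RatFunc.transcendental_of_ne_C (K := K) _ ?_ ⟨h, h0, hz⟩
      rintro ⟨c, hc'⟩
      apply hc
      refine ⟨c, IsFractionRing.injective K[X] (RatFunc K) ?_⟩
      rw [map_mul, RatFunc.algebraMap_C, ← hc']
      field_simp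
    set n := h.natDegree with hn
    -- `b ^ n * h (a / b)`, as a polynomial
    set w : K[X][Y] := ∑ i ∈ Finset.range (n + 1), C (C (h.coeff i)) * (a ^ i * b ^ (n - i)) with hw
    have hwE : algebraMap K[X][Y] E w = algebraMap K[X][Y] E b ^ n *
        aeval (algebraMap K[X][Y] E a / algebraMap K[X][Y] E b) h := by
      rw [hw, aeval_eq_sum_range, map_sum, Finset.mul_sum]
      refine Finset.sum_congr rfl fun i hi => ?_
      have hin : i ≤ n := by simpa [Nat.lt_succ_iff] using hi
      have h2 : algebraMap K[X][Y] E (C (C (h.coeff i))) = algebraMap K E (h.coeff i) :=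
        (IsScalarTower.algebraMap_apply K K[X][Y] E _).symm
      rw [map_mul, map_mul, map_pow, map_pow, h2, Algebra.smul_def, div_pow]
      have h3 : algebraMap K[X][Y] E b ^ n =
          algebraMap K[X][Y] E b ^ (n - i) * algebraMap K[X][Y] E b ^ i := by
        rw [← pow_add, Nat.sub_add_cancel hin]
      rw [h3]
      field_simp
    have hcoeff : w.coeff (n * d) ≠ 0 := by
      intro hz
      apply htr
      have hterm : ∀ i ∈ Finset.range (n + 1),
          (C (C (h.coeff i)) * (a ^ i * b ^ (n - i))).coeff (n * d) =
            C (h.coeff i) * (α ^ i * β ^ (n - i)) := by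
        intro i hi
        have hin : i ≤ n := by simpa [Nat.lt_succ_iff] using hi
        have h4 : n * d = i * d + (n - i) * d := by rw [← add_mul, Nat.add_sub_cancel' hin]
        rw [coeff_C_mul, h4, coeff_mul_add_eq_of_natDegree_le (natDegree_pow_le_of_le i hdeg.le)
          (natDegree_pow_le_of_le _ hd.ge), coeff_pow_of_natDegree_le hdeg.le,
          coeff_pow_of_natDegree_le hd.ge, hα, hβ, leadingCoeff, leadingCoeff, hdeg, ← hd]
      rw [hw, finsetSum_coeff, Finset.sum_congr rfl hterm] at hz
      have h5 := congrArg (algebraMap K[X] (RatFunc K)) hz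
      rw [map_sum, map_zero] at h5
      apply mul_left_cancel₀ (pow_ne_zero n hβR)
      rw [mul_zero, ← h5, aeval_eq_sum_range, Finset.mul_sum]
      refine Finset.sum_congr rfl fun i hi => ?_
      have hin : i ≤ n := by simpa [Nat.lt_succ_iff] using hi
      have h3 : algebraMap K[X] (RatFunc K) β ^ n =
          algebraMap K[X] (RatFunc K) β ^ (n - i) * algebraMap K[X] (RatFunc K) β ^ i := by
        rw [← pow_add, Nat.sub_add_cancel hin]
      rw [map_mul, map_mul, map_pow, map_pow, h3, Algebra.smul_def, div_pow,
        IsScalarTower.algebraMap_apply K K[X] (RatFunc K), Polynomial.algebraMap_eq]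
      field_simp
    have hw0 : w ≠ 0 := by rintro h; rw [h] at hcoeff; simp at hcoeff
    have hwdeg : w.natDegree = n * d := by
      apply le_antisymm _ (le_natDegree_of_ne_zero hcoeff)
      apply natDegree_sum_le_of_forall_le
      intro i hi
      have hin : i ≤ n := by simpa [Nat.lt_succ_iff] using hi
      refine (natDegree_C_mul_le _ _).trans (natDegree_mul_le.trans ?_)
      have h4 : n * d = i * d + (n - i) * d := by rw [← add_mul, Nat.add_sub_cancel' hin]
      rw [h4]
      exact add_le_add (natDegree_pow_le_of_le i hdeg.le) (natDegree_pow_le_of_le _ hd.ge)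
    have h6 := congrArg v hwE
    rw [hv w hw0, hwdeg, map_mul, map_pow, hv b hb0, ← exp_nsmul] at h6
    have h7 : (n • (b.natDegree : ℤ)) = ((n * d : ℕ) : ℤ) := by push_cast; simp [hd]
    rw [h7] at h6
    exact (mul_right_eq_self₀.1 h6.symm).resolve_right exp_ne_zero

/-- The degree in `Y` on the fraction field of `K[X][Y]`, with the two partial derivatives. -/
theorem exists_isDegreeValuation (K E : Type*) [Field K] [Field E] [Algebra K[X][Y] E]
    [IsFractionRing K[X][Y] E] [Algebra K E] [IsScalarTower K K[X][Y] E] :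
    ∃ (v : Valuation E ℤᵐ⁰) (D₁ D₂ : Derivation K E E), IsDegreeValuation v D₁ D₂ ∧
      (∀ a : K[X][Y], a ≠ 0 → v (algebraMap _ E a) = exp (a.natDegree : ℤ)) ∧
      ∀ a b : K[X][Y], jac D₁ D₂ (algebraMap _ E a) (algebraMap _ E b) =
        algebraMap _ E (jac (derivX K) (derivY K) a b) := by
  obtain ⟨v, hv⟩ := exists_degree_valuation K[X] E
  obtain ⟨D₁, hD₁⟩ := exists_derivation_extension (E := E) (derivX K)
  obtain ⟨D₂, hD₂⟩ := exists_derivation_extension (E := E) (derivY K)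
  have h1 : ∀ e, v (D₁ e) ≤ v e * 1 := by
    apply map_derivation_le (A := K[X][Y])
    intro a
    rw [hD₁, mul_one]
    by_cases h0 : derivX K a = 0
    · simp [h0]
    have ha : a ≠ 0 := by rintro rfl; simp at h0
    rw [hv _ h0, hv _ ha, exp_le_exp, Nat.cast_le]
    apply natDegree_le_natDegree
    rw [degree_le_iff_coeff_zero]
    intro i hi
    rw [coeff_derivX, coeff_eq_zero_of_degree_lt hi, derivative_zero]
  have h2 : ∀ e, v (D₂ e) ≤ v e * exp (-1) := by
    apply map_derivation_le (A := K[X][Y])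
    intro a
    rw [hD₂]
    by_cases h0 : derivY K a = 0
    · simp [h0]
    have ha : a ≠ 0 := by rintro rfl; simp at h0
    rw [hv _ h0, hv _ ha, ← exp_add, exp_le_exp]
    have := natDegree_derivative_lt (p := a) (fun h => h0 (by
      rw [derivY_apply, eq_C_of_natDegree_eq_zero h, derivative_C]))
    rw [derivY_apply]
    omega
  refine ⟨v, D₁, D₂, ⟨fun c hc => ?_, fun a b => ?_, residue_of_natDegree_valuation hv⟩, hv, ?_⟩
  · rw [IsScalarTower.algebraMap_apply K K[X][Y] E, hv]
    · have : algebraMap K K[X][Y] c = C (C c) := rfl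
      rw [this, natDegree_C]; simp
    · simpa using hc
  · have key : ∀ a b, v (D₁ a * D₂ b) ≤ v a * v b * exp (-1) := fun a b => by
      rw [map_mul, mul_assoc]
      exact mul_le_mul' (by simpa using h1 a) (h2 b)
    refine Valuation.map_sub_le _ (key a b) ?_
    rw [mul_comm (v a)]
    exact key b a
  · intro a b
    simp only [jac, hD₁, hD₂, map_sub, map_mul]

end Bivariate

end PolyAut

/-! ### The theorem of Jung and van der Kulk -/

namespace PolyAut

open Polynomial WithZero

open scoped Polynomial.Bivariate

section Plane

variable {K : Type*} [Field K]

theorem exists_aevalAeval_eq {f g : K[X][Y]} (h : Algebra.adjoin K {f, g} = ⊤) (w : K[X][Y]) :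
    ∃ P : K[X][Y], aevalAeval f g P = w := by
  have h1 : Algebra.adjoin K {f, g} ≤ (aevalAeval (R := K) f g).range := by
    rw [Algebra.adjoin_le_iff]
    rintro x (rfl | rfl)
    · exact ⟨C X, aevalAeval_X _ _⟩
    · exact ⟨Y, aevalAeval_Y _ _⟩
  rw [h] at h1
  exact h1 Algebra.mem_top

theorem aeval_C_eq (q p : K[X]) : aeval (C q : K[X][Y]) p = C (aeval q p) := by
  induction p using Polynomial.induction_on' with
  | add a b ha hb => simp only [map_add, ha, hb]
  | monomial m c =>
    simp only [aeval_monomial, C_mul, C_pow]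
    rfl

theorem aevalAeval_C_left (p : K[X]) (g P : K[X][Y]) :
    aevalAeval (C p) g P = (P.map (compRingHom p)).comp g := by
  induction P using Polynomial.induction_on' with
  | add P Q hP hQ => simp only [map_add, hP, hQ, Polynomial.map_add, add_comp]
  | monomial n a =>
    rw [← C_mul_X_pow_eq_monomial, map_mul, map_pow, aevalAeval_Y, aevalAeval_C]
    simp only [Polynomial.map_mul, Polynomial.map_pow, map_X, map_C, mul_comp, pow_comp, X_comp,
      C_comp, coe_compRingHom]
    congr 1
    rw [aeval_C_eq]
    rfl

/-- If both members of a pair of coordinates have positive degree in `Y`, then one of them can be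
reduced by a multiple of a power of the other. This is the heart of the theorem of Jung and van der
Kulk: `X` has degree zero in `Y`, but if neither degree divides the other, the estimate
`IsDegreeValuation.le_map_laurentEval` makes the degree of every nonconstant polynomial in `f, g`
positive. -/
theorem exists_reduction (E : Type*) [Field E] [Algebra K[X][Y] E] [IsFractionRing K[X][Y] E]
    [Algebra K E] [IsScalarTower K K[X][Y] E] {f g : K[X][Y]} (hfg : Algebra.adjoin K {f, g} = ⊤)
    (hj : jac (derivX K) (derivY K) f g = 1) (hf : 0 < f.natDegree) (hg : 0 < g.natDegree) :
    (∃ (c : K) (j : ℕ), (f - C (C c) * g ^ j).natDegree < f.natDegree) ∨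
      ∃ (c : K) (j : ℕ), (g - C (C c) * f ^ j).natDegree < g.natDegree := by
  classical
  obtain ⟨v, D₁, D₂, hv, hdeg, hjac⟩ := exists_isDegreeValuation K E
  have hf0 : f ≠ 0 := by rintro rfl; simp at hf
  have hg0 : g ≠ 0 := by rintro rfl; simp at hg
  set s := algebraMap K[X][Y] E f with hs
  set t := algebraMap K[X][Y] E g with ht
  have hs0 : s ≠ 0 := by simpa [hs] using hf0
  have ht0 : t ≠ 0 := by simpa [ht] using hg0
  obtain ⟨e, a, b, x, y, he, ha, hb, hab⟩ : ∃ (e a b : ℕ) (x y : ℤ), 0 < e ∧ f.natDegree = e * a ∧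
      g.natDegree = e * b ∧ x * a + y * b = 1 := by
    have hpos : 0 < Nat.gcd f.natDegree g.natDegree := Nat.gcd_pos_of_pos_left _ hf
    obtain ⟨a, ha⟩ := Nat.gcd_dvd_left f.natDegree g.natDegree
    obtain ⟨b, hb⟩ := Nat.gcd_dvd_right f.natDegree g.natDegree
    refine ⟨_, a, b, Nat.gcdA f.natDegree g.natDegree, Nat.gcdB f.natDegree g.natDegree, hpos,
      ha, hb, ?_⟩
    have h1 := Nat.gcd_eq_gcd_ab f.natDegree g.natDegree
    have hne : ((Nat.gcd f.natDegree g.natDegree : ℕ) : ℤ) ≠ 0 := by exact_mod_cast hpos.ne'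
    have ha' : (f.natDegree : ℤ) = (Nat.gcd f.natDegree g.natDegree : ℕ) * a := by
      exact_mod_cast ha
    have hb' : (g.natDegree : ℤ) = (Nat.gcd f.natDegree g.natDegree : ℕ) * b := by
      exact_mod_cast hb
    apply mul_left_cancel₀ hne
    linear_combination -h1 - (Nat.gcdA f.natDegree g.natDegree) * ha' -
      (Nat.gcdB f.natDegree g.natDegree) * hb'
  have ha0 : 0 < a := Nat.pos_of_ne_zero (by rintro rfl; omega)
  have hb0 : 0 < b := Nat.pos_of_ne_zero (by rintro rfl; omega)
  have vs : v s = exp ((e : ℤ) * a) := by rw [hs, hdeg f hf0, ha]; push_cast; rfl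
  have vt : v t = exp ((e : ℤ) * b) := by rw [ht, hdeg g hg0, hb]; push_cast; rfl
  have vu : v (s ^ (-(b : ℤ)) * t ^ (a : ℤ)) = 1 := by
    rw [map_mul, map_zpow₀, map_zpow₀, vs, vt, ← exp_zsmul, ← exp_zsmul, ← exp_add, ← exp_zero]
    congr 1; simp only [smul_eq_mul]; ring
  have vj : v (jac D₁ D₂ s t) = 1 := by rw [hs, ht, hjac, hj, map_one, map_one]
  -- `X` as a polynomial in `f` and `g`
  obtain ⟨P, hP⟩ := exists_aevalAeval_eq hfg (C X)
  set G : ℤ × ℤ → K := fun p => (P.coeff p.2.toNat).coeff p.1.toNat with hG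
  set ι : ℕ × ℕ → ℤ × ℤ := fun p => (p.1, p.2) with hι
  obtain ⟨d, hd⟩ : ∃ d, ∀ j, (P.coeff j).natDegree < d := by
    refine ⟨∑ j ∈ P.support, (P.coeff j).natDegree + 1, fun j => ?_⟩
    by_cases hj : j ∈ P.support
    · have := Finset.single_le_sum (f := fun j => (P.coeff j).natDegree)
        (fun _ _ => Nat.zero_le _) hj
      omega
    · rw [notMem_support_iff.1 hj]; simp
  set I : Finset (ℤ × ℤ) :=
    (Finset.range d ×ˢ Finset.range (P.natDegree + 1)).image ι with hI
  have heval : laurentEval I G s t = algebraMap K[X][Y] E (C X) := by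
    rw [laurentEval, hI, Finset.sum_image (by
      rintro ⟨i, j⟩ - ⟨i', j'⟩ - h
      simpa [hι] using h), Finset.sum_product_right, ← hP]
    conv_rhs => rw [P.as_sum_range_C_mul_X_pow]
    rw [map_sum, map_sum]
    refine Finset.sum_congr rfl fun j _ => ?_
    rw [map_mul, map_pow, aevalAeval_Y, aevalAeval_C, map_mul, map_pow, ← ht,
      aeval_eq_sum_range' (hd j), map_sum, Finset.sum_mul]
    refine Finset.sum_congr rfl fun i _ => ?_
    simp only [hG, hι, Int.toNat_natCast, zpow_natCast, Algebra.smul_def, map_mul, map_pow, ← hs]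
    rw [← IsScalarTower.algebraMap_apply K K[X][Y] E]
    ring
  have hmemI : ∀ i j, (P.coeff j).coeff i ≠ 0 → ι (i, j) ∈ I := by
    intro i j hij
    have h1 : i < d := by
      have h1 := hd j
      have h2 := le_natDegree_of_ne_zero hij
      omega
    have h2 : j < P.natDegree + 1 := by
      by_contra! h
      rw [coeff_eq_zero_of_natDegree_lt (p := P) (n := j) (by omega)] at hij
      simp at hij
    exact Finset.mem_image_of_mem _ (by
      simp only [Finset.mem_product, Finset.mem_range]; exact ⟨h1, h2⟩)
  have hIpos : ∀ p ∈ I, 0 ≤ p.1 ∧ 0 ≤ p.2 := by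
    intro p hp
    simp only [hI, Finset.mem_image] at hp
    obtain ⟨q, -, rfl⟩ := hp
    simp [hι]
  -- `X` is not a constant, so `P` is not a constant
  obtain ⟨i₁, j₁, hij, hpos₁⟩ : ∃ i j, (P.coeff j).coeff i ≠ 0 ∧ 0 < i + j := by
    by_contra! hcon
    have : P = C (C ((P.coeff 0).coeff 0)) := by
      ext j i
      rw [coeff_C]
      split_ifs with h
      · subst h
        rw [coeff_C]
        split_ifs with h
        · rw [h]
        · by_contra hne
          have := hcon _ _ hne
          omega
      · by_contra hne
        have := hcon _ _ hne
        omega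
    rw [this, aevalAeval_C, aeval_C] at hP
    have h2 := congrArg natDegree (C_injective (hP : C (C _) = C X))
    simp at h2
  obtain ⟨p₀, hp₀, hp₀max⟩ := Finset.exists_max_image (I.filter fun p => G p ≠ 0)
    (fun p => (a : ℤ) * p.1 + b * p.2) ⟨ι (i₁, j₁), by
      simp only [Finset.mem_filter]; exact ⟨hmemI _ _ hij, by simpa [hG, hι] using hij⟩⟩
  simp only [Finset.mem_filter] at hp₀ hp₀max
  set μ : ℤ := a * p₀.1 + b * p₀.2 with hμ
  have hμpos : 0 < μ := by
    have h1 := hp₀max (ι (i₁, j₁)) ⟨hmemI _ _ hij, by simpa [hG, hι] using hij⟩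
    simp only [hι] at h1
    refine lt_of_lt_of_le ?_ h1
    rcases Nat.eq_zero_or_pos i₁ with h | h
    · have : 0 < j₁ := by omega
      positivity
    · positivity
  have hvX : v (laurentEval I G s t) = exp 0 := by
    rw [heval, hdeg _ (by simp), natDegree_C]; rfl
  have hez : (0 : ℤ) < e := by exact_mod_cast he
  have haz : (0 : ℤ) < a := by exact_mod_cast ha0
  have hbz : (0 : ℤ) < b := by exact_mod_cast hb0
  obtain ⟨c, hc⟩ : ∃ c : K, v (s ^ (-(b : ℤ)) * t ^ (a : ℤ) - algebraMap K E c) < 1 := by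
    refine (hv.residue _ vu).resolve_right fun htr => ?_
    have h1 := map_laurentEval_of_transcendental hez hab vs vt htr ⟨p₀, hp₀.1, hp₀.2, rfl⟩
      (fun p hp hGp => hp₀max p ⟨hp, hGp⟩)
    rw [hvX, exp_inj, ← hμ] at h1
    nlinarith
  have hcE : ∀ c : K, algebraMap K E c = algebraMap K[X][Y] E (C (C c)) := fun c =>
    IsScalarTower.algebraMap_apply K K[X][Y] E c
  have hlt : ∀ p q : K[X][Y], 0 < q.natDegree →
      v (algebraMap K[X][Y] E p) < v (algebraMap K[X][Y] E q) → p.natDegree < q.natDegree := by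
    intro p q hq hpq
    by_cases hp : p = 0
    · simpa [hp] using hq
    have hq0 : q ≠ 0 := by rintro rfl; simp at hq
    rw [hdeg p hp, hdeg q hq0, exp_lt_exp] at hpq
    exact_mod_cast hpq
  by_cases ha1 : a = 1
  · right
    refine ⟨c, b, hlt _ _ hg ?_⟩
    have h1 : algebraMap K[X][Y] E (g - C (C c) * f ^ b) =
        s ^ b * (s ^ (-(b : ℤ)) * t ^ (a : ℤ) - algebraMap K E c) := by
      rw [map_sub, map_mul, map_pow, ← hs, ← ht, ← hcE, ha1]
      simp only [zpow_neg, zpow_natCast, pow_one]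
      field_simp
    rw [h1, map_mul]
    have h2 : v (s ^ b) = v t := by
      rw [map_pow, vs, vt, ha1, ← exp_nsmul]; congr 1; simp [mul_comm]
    rw [h2, ← ht]
    exact mul_lt_of_lt_one_right ((Valuation.pos_iff v).2 ht0) hc
  by_cases hb1 : b = 1
  · left
    have hc0 : c ≠ 0 := by
      rintro rfl
      rw [map_zero, sub_zero, vu] at hc
      exact lt_irrefl _ hc
    refine ⟨c⁻¹, a, hlt _ _ hf ?_⟩
    have h1 : algebraMap K[X][Y] E (f - C (C c⁻¹) * g ^ a) =
        (-algebraMap K E c⁻¹ * s) * (s ^ (-(b : ℤ)) * t ^ (a : ℤ) - algebraMap K E c) := by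
      have hcE0 : algebraMap K E c ≠ 0 := by simpa using hc0
      rw [map_sub, map_mul, map_pow, ← hs, ← ht, ← hcE, hb1, map_inv₀]
      simp only [zpow_neg, zpow_natCast, pow_one]
      field_simp
      ring
    rw [h1, map_mul, map_mul, Valuation.map_neg, hv.map_const _ (inv_ne_zero hc0), one_mul]
    exact mul_lt_of_lt_one_right ((Valuation.pos_iff v).2 hs0) hc
  -- Neither degree divides the other, so `X` cannot have degree zero.
  exfalso
  have ha2 : (2 : ℤ) ≤ a := by exact_mod_cast (by omega : 2 ≤ a)
  have hb2 : (2 : ℤ) ≤ b := by exact_mod_cast (by omega : 2 ≤ b)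
  -- The top-degree part of `P` lies on a segment with steps `(-b, a)` in the first quadrant, which
  -- bounds its number of terms.
  set k : ℤ := μ / (a * b) with hk
  have hk0 : 0 ≤ k := Int.ediv_nonneg hμpos.le (by positivity)
  have hΛ : ((e * a + e * b - 1 : ℕ) : ℤ) = e * a + e * b - 1 := by
    have : 0 < e * a := by positivity
    have : 1 ≤ e * a + e * b := by omega
    push_cast [Nat.cast_sub this]
    rfl
  -- Since the bracket of `f` and `g` has degree zero, the constant `Λ` is `deg f + deg g - 1`.
  have main := hv.le_map_laurentEval (e * a + e * b - 1) hez hab vs vt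
    (by rw [vj, hΛ, ← exp_zero]; congr 1; ring) (k := k.toNat)
    ⟨p₀, hp₀.1, hp₀.2, rfl⟩ (fun p hp hGp => hp₀max p ⟨hp, hGp⟩)
    (by
      intro p hp p' hp' hGp hGp' hpμ l hl1 hl2
      rw [Int.toNat_of_nonneg hk0, hk, Int.le_ediv_iff_mul_le (by positivity)]
      have h1 := hIpos p hp
      have h2 := hIpos p' hp'
      nlinarith)
  rw [hvX, exp_le_exp, hΛ, Int.toNat_of_nonneg hk0, ← hμ] at main
  have h1 : k * (a * b) ≤ μ := Int.ediv_mul_le _ (by positivity)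
  have h2 : (a : ℤ) + b ≤ a * b := by nlinarith
  have h3 : (e : ℤ) * (k * (a + b)) ≤ e * μ :=
    mul_le_mul_of_nonneg_left ((mul_le_mul_of_nonneg_left h2 hk0).trans h1) hez.le
  have h4 : (0 : ℤ) < e * μ := by positivity
  have h5 : k ≤ 0 := by linarith
  have h6 : k = 0 := le_antisymm h5 hk0
  rw [h6] at main
  linarith

/-- The matrix with rows `(0, c)` and `(-c⁻¹, 0)` is a product of three elementary matrices. -/
theorem pair_smul_of_elementary {M : K[X][Y] → K[X][Y] → Prop}
    (h₁ : ∀ f g (c : K) (j : ℕ), M f g → M (f + C (C c) * g ^ j) g)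
    (h₂ : ∀ f g (c : K) (j : ℕ), M f g → M f (g + C (C c) * f ^ j))
    {f g : K[X][Y]} (h : M f g) {c : K} (hc : c ≠ 0) :
    M (C (C c) * g) (-(C (C c⁻¹) * f)) := by
  have hcc : (C (C c) : K[X][Y]) * C (C c⁻¹) = 1 := by
    rw [← C_mul, ← C_mul, mul_inv_cancel₀ hc, C_1, C_1]
  convert! h₁ _ _ c 1 (h₂ _ _ (-c⁻¹) 1 (h₁ _ _ c 1 h)) using 1
  · simp only [C_neg, pow_one]
    linear_combination (f + C (C c) * g) * hcc
  · simp only [C_neg, pow_one]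
    linear_combination g * hcc

/-- An induction principle for the automorphisms of the plane with Jacobian determinant one, over an
arbitrary field: they are products of elementary ones (the theorem of Jung and van der Kulk). -/
theorem plane_induction {M : K[X][Y] → K[X][Y] → Prop} (h₀ : M (C X) Y)
    (h₁ : ∀ f g (c : K) (j : ℕ), M f g → M (f + C (C c) * g ^ j) g)
    (h₂ : ∀ f g (c : K) (j : ℕ), M f g → M f (g + C (C c) * f ^ j))
    {f g : K[X][Y]} (hfg : Algebra.adjoin K {f, g} = ⊤)
    (hj : jac (derivX K) (derivY K) f g = 1) : M f g := by
  have weyl : ∀ {f g : K[X][Y]} {c : K}, M f g → c ≠ 0 → M (C (C c) * g) (-(C (C c⁻¹) * f)) :=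
    fun h hc => pair_smul_of_elementary h₁ h₂ h hc
  -- A coordinate of degree zero in `Y` is `a * X + b`; its partner is then `a⁻¹ * Y + β(X)`.
  have base : ∀ f g : K[X][Y], Algebra.adjoin K {f, g} = ⊤ →
      jac (derivX K) (derivY K) f g = 1 → f.natDegree = 0 → M f g := by
    intro f g hfg hj hf
    obtain ⟨p, rfl⟩ : ∃ p, f = C p := ⟨_, eq_C_of_natDegree_eq_zero hf⟩
    obtain ⟨P, hP⟩ := exists_aevalAeval_eq hfg (C X)
    obtain ⟨Q, hQ⟩ := exists_aevalAeval_eq hfg Y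
    rw [aevalAeval_C_left] at hP hQ
    have hQd := congrArg natDegree hQ
    rw [natDegree_comp, natDegree_X] at hQd
    have hg1 : g.natDegree = 1 := Nat.eq_one_of_mul_eq_one_left hQd
    have hPd := congrArg natDegree hP
    rw [natDegree_comp, natDegree_C, hg1, mul_one] at hPd
    rw [eq_C_of_natDegree_eq_zero hPd, C_comp, coeff_map] at hP
    have hp1 := congrArg natDegree (C_injective hP)
    rw [coe_compRingHom, natDegree_comp, natDegree_X] at hp1
    replace hp1 : p.natDegree = 1 := Nat.eq_one_of_mul_eq_one_left hp1
    obtain ⟨α, β, rfl⟩ : ∃ α β, g = C α * Y + C β :=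
      ⟨_, _, eq_X_add_C_of_natDegree_le_one hg1.le⟩
    obtain ⟨a, b, rfl⟩ : ∃ a b, p = C a * X + C b :=
      ⟨_, _, eq_X_add_C_of_natDegree_le_one hp1.le⟩
    have hα : C a * α = 1 := by
      apply C_injective (R := K[X])
      rw [← C_1] at hj
      rw [← hj]
      simp [jac, derivX_C, derivY_apply]
    have ha : a ≠ 0 := by rintro rfl; simp at hα
    have hα' : α = C a⁻¹ := by
      apply mul_left_cancel₀ (C_ne_zero.2 ha)
      rw [hα, ← C_mul, mul_inv_cancel₀ ha, C_1]
    have h3 : M (C (C a * X)) (C (C a⁻¹) * Y) := by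
      convert! weyl (weyl h₀ one_ne_zero) (neg_ne_zero.2 ha) using 1
      · simp only [C_neg, C_mul, C_1, inv_one, one_mul]; ring
      · simp only [inv_neg, C_neg, C_1, one_mul]; ring
    have h4 : M (C (C a * X + C b)) (C (C a⁻¹) * Y) := by
      convert! h₁ _ _ b 0 h3 using 1
      simp
    have h5 : ∀ γ : K[X], M (C (C a * X + C b)) (C (C a⁻¹) * Y + aeval (C (C a * X + C b)) γ) := by
      intro γ
      -- The second component is arbitrary here, so that monomials can be added one by one.
      have h6 : ∀ G, M (C (C a * X + C b)) G →
          M (C (C a * X + C b)) (G + aeval (C (C a * X + C b)) γ) := by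
        induction γ using Polynomial.induction_on' with
        | add p q hp hq =>
          intro G hG
          rw [map_add (aeval _), ← add_assoc]
          exact hq _ (hp _ hG)
        | monomial n c =>
          intro G hG
          rw [aeval_monomial]
          exact h₂ _ _ c n hG
      exact h6 _ h4
    have h6 : aeval (C a * X + C b : K[X]) (C a⁻¹ * (X - C b)) = X := by
      have : (C a⁻¹ : K[X]) * C a = 1 := by rw [← C_mul, inv_mul_cancel₀ ha, C_1]
      simp only [map_mul, map_sub, aeval_C, aeval_X, Polynomial.algebraMap_eq]
      linear_combination (X : K[X]) * this
    have h7 := h5 (β.comp (C a⁻¹ * (X - C b)))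
    rw [aeval_C_eq, aeval_comp, h6, aeval_X_left_apply] at h7
    rw [hα']
    exact h7
  induction hn : f.natDegree + g.natDegree using Nat.strong_induction_on generalizing f g with
  | _ n ih =>
  rcases Nat.eq_zero_or_pos f.natDegree with hf | hf
  · exact base f g hfg hj hf
  rcases Nat.eq_zero_or_pos g.natDegree with hg | hg
  · have h3 : M (-g) f := by
      apply base
      · rw [eq_top_iff, ← hfg, Algebra.adjoin_le_iff]
        rintro x (rfl | rfl)
        · exact Algebra.subset_adjoin (by simp)
        · rw [← neg_neg x]
          exact neg_mem (Algebra.subset_adjoin (by simp))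
      · rw [← hj]
        simp only [jac, map_neg]
        ring
      · rwa [natDegree_neg]
    convert! weyl h3 one_ne_zero using 1 <;> simp
  have adj : ∀ f' g', f ∈ Algebra.adjoin K {f', g'} → g ∈ Algebra.adjoin K {f', g'} →
      Algebra.adjoin K {f', g'} = ⊤ := by
    intro f' g' h3 h4
    rw [eq_top_iff, ← hfg, Algebra.adjoin_le_iff]
    rintro x (rfl | rfl) <;> assumption
  have hC : ∀ c : K, derivX K (C (C c)) = 0 ∧ derivY K (C (C c)) = 0 := fun c =>
    ⟨(derivX K).map_algebraMap c, (derivY K).map_algebraMap c⟩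
  rcases exists_reduction (FractionRing K[X][Y]) hfg hj hf hg with ⟨c, j, hc⟩ | ⟨c, j, hc⟩
  · have h3 := ih _ (by omega) (f := f - C (C c) * g ^ j) (g := g) (by
      have hg' : g ∈ Algebra.adjoin K {f - C (C c) * g ^ j, g} := Algebra.subset_adjoin (by simp)
      refine adj _ _ ?_ hg'
      have h4 : f - C (C c) * g ^ j ∈ Algebra.adjoin K {f - C (C c) * g ^ j, g} :=
        Algebra.subset_adjoin (by simp)
      have h5 := add_mem h4 (mul_mem (Subalgebra.algebraMap_mem _ c) (pow_mem hg' j))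
      rwa [show algebraMap K K[X][Y] c = C (C c) from rfl, sub_add_cancel] at h5) (by
      rw [← hj]
      simp only [jac, map_sub, Derivation.leibniz, Derivation.leibniz_pow, hC, smul_eq_mul,
        mul_zero, add_zero, nsmul_eq_mul]
      ring) rfl
    convert! h₁ _ _ c j h3 using 1
    ring
  · have h3 := ih _ (by omega) (f := f) (g := g - C (C c) * f ^ j) (by
      have hf' : f ∈ Algebra.adjoin K {f, g - C (C c) * f ^ j} := Algebra.subset_adjoin (by simp)
      refine adj _ _ hf' ?_
      have h4 : g - C (C c) * f ^ j ∈ Algebra.adjoin K {f, g - C (C c) * f ^ j} :=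
        Algebra.subset_adjoin (by simp)
      have h5 := add_mem h4 (mul_mem (Subalgebra.algebraMap_mem _ c) (pow_mem hf' j))
      rwa [show algebraMap K K[X][Y] c = C (C c) from rfl, sub_add_cancel] at h5) (by
      rw [← hj]
      simp only [jac, map_sub, Derivation.leibniz, Derivation.leibniz_pow, hC, smul_eq_mul,
        mul_zero, add_zero, nsmul_eq_mul]
      ring) rfl
    convert! h₂ _ _ c j h3 using 1
    ring

end Plane

end PolyAut

/-! ### Tame shears, the Jacobian determinant and specialization -/

namespace PolyAut

open Polynomial

open scoped Polynomial.Bivariate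

section Generators

variable {k : Type u} [Field k]

theorem exists_comp_eq {n : ℕ} {φ ψ : Fin n → MvPolynomial (Fin n) k}
    (h₁ : ∀ i, MvPolynomial.aeval φ (ψ i) = MvPolynomial.X i)
    (h₂ : ∀ i, MvPolynomial.aeval ψ (φ i) = MvPolynomial.X i) :
    ∃ F : GA n k, comp F = φ := by
  refine ⟨MulOpposite.op (AlgEquiv.ofAlgHom (MvPolynomial.aeval φ) (MvPolynomial.aeval ψ) ?_ ?_),
    ?_⟩
  · ext i : 1; simpa using h₁ i
  · ext i : 1; simpa using h₂ i
  · funext i; simp [comp]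

theorem exists_scaling (i : Fin 3) {c : k} (hc : c ≠ 0) :
    ∃ D ∈ TA 3 k, comp D =
      Function.update MvPolynomial.X i (MvPolynomial.C c * MvPolynomial.X i) := by
  have key : ∀ {a b : k}, a * b = 1 → ∀ j, MvPolynomial.aeval
      (Function.update MvPolynomial.X i (MvPolynomial.C a * MvPolynomial.X i))
      ((Function.update MvPolynomial.X i (MvPolynomial.C b * MvPolynomial.X i) :
        Fin 3 → MvPolynomial (Fin 3) k) j) = MvPolynomial.X j := by
    intro a b hab j
    by_cases h : j = i
    · subst h
      simp only [Function.update_self, map_mul, MvPolynomial.aeval_X, ← MvPolynomial.algebraMap_eq,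
        AlgHom.commutes]
      rw [← mul_assoc, ← map_mul, mul_comm b, hab, map_one, one_mul]
    · simp [Function.update_of_ne h]
  obtain ⟨D, hD⟩ := exists_comp_eq (key (mul_inv_cancel₀ hc)) (key (inv_mul_cancel₀ hc))
  refine ⟨D, Subgroup.subset_closure (Or.inl fun j => ?_), hD⟩
  rw [hD]
  by_cases h : j = i
  · subst h
    rw [Function.update_self]
    refine (MvPolynomial.totalDegree_mul _ _).trans ?_
    simp
  · rw [Function.update_of_ne h]
    simp

theorem exists_swap (i j : Fin 3) :
    ∃ A ∈ TA 3 k, comp A = fun l => MvPolynomial.X (Equiv.swap i j l) := by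
  have key : ∀ l, MvPolynomial.aeval
      (fun l => (MvPolynomial.X (Equiv.swap i j l) : MvPolynomial (Fin 3) k))
      (MvPolynomial.X (Equiv.swap i j l) : MvPolynomial (Fin 3) k) = MvPolynomial.X l := by
    intro l
    simp
  obtain ⟨A, hA⟩ := exists_comp_eq key key
  refine ⟨A, Subgroup.subset_closure (Or.inl fun l => ?_), hA⟩
  rw [hA]
  simp

theorem evalMap_scaling {L : Type*} [CommRing L] [Algebra k L] {i : Fin 3} {c : k} {D : GA 3 k}
    (hD : comp D = Function.update MvPolynomial.X i (MvPolynomial.C c * MvPolynomial.X i))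
    (x : Fin 3 → L) :
    evalMap L D x = Function.update x i (algebraMap k L c * x i) := by
  funext j
  rw [evalMap, hD]
  by_cases h : j = i
  · subst h
    simp
  · simp [Function.update_of_ne h]

/-- The tame subgroup realises every map `X_i ↦ X_i + e(X_l) * X_j ^ n` with `j, l ≠ i`. -/
theorem exists_shear {i j l : Fin 3} (hj : j ≠ i) (hl : l ≠ i) (n : ℕ) (e : k[X]) :
    ∃ E ∈ TA 3 k, ∀ (L : Type v) [Field L] [Algebra k L] (x : Fin 3 → L),
      evalMap L E x = Function.update x i (x i + aeval (x l) e * x j ^ n) := by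
  induction e using Polynomial.induction_on' with
  | add p q hp hq =>
    obtain ⟨E, hE, hE'⟩ := hp
    obtain ⟨E₂, hE₂, hE₂'⟩ := hq
    refine ⟨E * E₂, mul_mem hE hE₂, fun L _ _ x => ?_⟩
    rw [evalMap_mul, hE₂', hE', Function.update_idem]
    congr 1
    rw [Function.update_self, Function.update_of_ne hl, Function.update_of_ne hj, map_add]
    ring
  | monomial m c =>
    by_cases hc : c = 0
    · subst hc
      exact ⟨1, one_mem _, fun L _ _ x => by simp [evalMap_one]⟩
    set μ : MvPolynomial (Fin 3) k := MvPolynomial.X l ^ m * MvPolynomial.X j ^ n with hμ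
    have key : ∀ {s t : k}, s + t = 0 → ∀ w, MvPolynomial.aeval
        (Function.update MvPolynomial.X i (MvPolynomial.X i + MvPolynomial.C s * μ))
        ((Function.update MvPolynomial.X i (MvPolynomial.X i + MvPolynomial.C t * μ) :
          Fin 3 → MvPolynomial (Fin 3) k) w) = MvPolynomial.X w := by
      intro s t hst w
      by_cases h : w = i
      · subst h
        simp only [Function.update_self, map_add, map_mul, hμ, map_pow, MvPolynomial.aeval_X,
          Function.update_of_ne hl, Function.update_of_ne hj, ← MvPolynomial.algebraMap_eq,
          AlgHom.commutes]
        rw [add_assoc, ← add_mul, ← map_add, hst, map_zero, zero_mul, add_zero]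
      · simp [Function.update_of_ne h]
    obtain ⟨E, hE⟩ := exists_comp_eq (key (add_neg_cancel (1 : k))) (key (neg_add_cancel (1 : k)))
    have hET : E ∈ TA 3 k := by
      refine Subgroup.subset_closure (Or.inr ⟨i, Finsupp.single l m + Finsupp.single j n, ?_, ?_,
        fun w hw => ?_⟩)
      · simp [hj, hl]
      · rw [hE, Function.update_self, MvPolynomial.C_1, one_mul, hμ, MvPolynomial.X_pow_eq_monomial,
          MvPolynomial.X_pow_eq_monomial, MvPolynomial.monomial_mul, one_mul]
      · rw [hE, Function.update_of_ne hw]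
    -- A scalar coefficient is introduced by conjugating with a diagonal automorphism.
    obtain ⟨D, hD, hD'⟩ := exists_scaling i hc
    obtain ⟨D₂, hD₂, hD₂'⟩ := exists_scaling i (inv_ne_zero hc)
    refine ⟨D * E * D₂, mul_mem (mul_mem hD hET) hD₂, fun L _ _ x => ?_⟩
    have hEx : ∀ y : Fin 3 → L, evalMap L E y = Function.update y i (y i + y l ^ m * y j ^ n) := by
      intro y
      funext w
      rw [evalMap, hE]
      by_cases h : w = i
      · subst h
        simp [hμ]
      · simp [Function.update_of_ne h]
    rw [evalMap_mul, evalMap_mul, evalMap_scaling hD₂', hEx, evalMap_scaling hD',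
      Function.update_idem, Function.update_idem]
    congr 1
    have hcL : algebraMap k L c ≠ 0 := by simpa using hc
    rw [Function.update_self, Function.update_self, Function.update_of_ne hl,
      Function.update_of_ne hj, aeval_monomial, map_inv₀]
    field_simp

end Generators

section Jacobian

variable {k : Type u} [Field k]

theorem dvd_jac_unop {D₁ D₂ : Derivation k (MvPolynomial (Fin 3) k) (MvPolynomial (Fin 3) k)}
    (F : GA 3 k) {J a : MvPolynomial (Fin 3) k} (h : ∀ i, J ∣ jac D₁ D₂ a (comp F i))
    (p : MvPolynomial (Fin 3) k) : J ∣ jac D₁ D₂ a (F.unop p) := by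
  rw [unop_apply]
  induction p using MvPolynomial.induction_on with
  | C c => simp [jac, ← MvPolynomial.algebraMap_eq]
  | add p q hp hq =>
    have : jac D₁ D₂ a (MvPolynomial.aeval (comp F) (p + q)) =
        jac D₁ D₂ a (MvPolynomial.aeval (comp F) p) +
        jac D₁ D₂ a (MvPolynomial.aeval (comp F) q) := by
      simp only [jac, map_add]; ring
    rw [this]
    exact dvd_add hp hq
  | mul_X p i hp =>
    have : jac D₁ D₂ a (MvPolynomial.aeval (comp F) (p * MvPolynomial.X i)) =
        MvPolynomial.aeval (comp F) p * jac D₁ D₂ a (comp F i) +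
        comp F i * jac D₁ D₂ a (MvPolynomial.aeval (comp F) p) := by
      simp only [jac, map_mul, MvPolynomial.aeval_X, Derivation.leibniz, smul_eq_mul]; ring
    rw [this]
    exact dvd_add (dvd_mul_of_dvd_right (h i) _) (dvd_mul_of_dvd_right hp _)

theorem jac_swap {R A : Type*} [CommRing R] [CommRing A] [Algebra R A] (D₁ D₂ : Derivation R A A)
    (a b : A) : jac D₁ D₂ a b = - jac D₁ D₂ b a := by
  simp only [jac]; ring

/-- The Jacobian determinant of an automorphism fixing the last variable is a constant. -/
theorem exists_jac_eq_C {F : GA 3 k} (hF : comp F 2 = MvPolynomial.X 2) :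
    ∃ c : k, c ≠ 0 ∧ jac (MvPolynomial.pderiv 0) (MvPolynomial.pderiv 1) (comp F 0) (comp F 1) =
      MvPolynomial.C c := by
  set D₁ : Derivation k (MvPolynomial (Fin 3) k) (MvPolynomial (Fin 3) k) := MvPolynomial.pderiv 0
  set D₂ : Derivation k (MvPolynomial (Fin 3) k) (MvPolynomial (Fin 3) k) := MvPolynomial.pderiv 1
  set J := jac D₁ D₂ (comp F 0) (comp F 1) with hJ
  have h2 : ∀ a, jac D₁ D₂ a (comp F 2) = 0 := by
    intro a
    rw [hF]
    have h₁ : D₁ (MvPolynomial.X 2) = 0 := MvPolynomial.pderiv_X_of_ne (by decide)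
    have h₂ : D₂ (MvPolynomial.X 2) = 0 := MvPolynomial.pderiv_X_of_ne (by decide)
    rw [jac, h₁, h₂, mul_zero, zero_mul, sub_zero]
  have hself : ∀ a, jac D₁ D₂ a a = 0 := fun a => by simp only [jac]; ring
  have hgen : ∀ i j, J ∣ jac D₁ D₂ (comp F i) (comp F j) := by
    intro i j
    fin_cases j
    · fin_cases i
      · exact ⟨0, by rw [mul_zero]; exact hself _⟩
      · exact ⟨-1, by rw [mul_neg_one]; exact jac_swap _ _ _ _⟩
      · refine ⟨0, ?_⟩
        rw [mul_zero, jac_swap]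
        exact neg_eq_zero.2 (h2 _)
    · fin_cases i
      · exact dvd_rfl
      · exact ⟨0, by rw [mul_zero]; exact hself _⟩
      · refine ⟨0, ?_⟩
        rw [mul_zero, jac_swap]
        exact neg_eq_zero.2 (h2 _)
    · exact ⟨0, by rw [mul_zero]; exact h2 _⟩
  have hall : ∀ p q, J ∣ jac D₁ D₂ (F.unop p) (F.unop q) := by
    intro p q
    refine dvd_jac_unop F (fun i => ?_) q
    rw [jac_swap, dvd_neg]
    exact dvd_jac_unop F (fun j => hgen i j) p
  have hone := hall (F.unop.symm (MvPolynomial.X 0)) (F.unop.symm (MvPolynomial.X 1))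
  rw [AlgEquiv.apply_symm_apply, AlgEquiv.apply_symm_apply] at hone
  have h1 : jac D₁ D₂ (MvPolynomial.X 0) (MvPolynomial.X 1) = 1 := by
    simp [jac, D₁, D₂, MvPolynomial.pderiv_X]
  rw [h1] at hone
  obtain ⟨c, hc, hc'⟩ := MvPolynomial.isUnit_iff_eq_C_of_isReduced.1 (isUnit_of_dvd_one hone)
  exact ⟨c, hc.ne_zero, hc'⟩

end Jacobian

section Specialization

variable {k κ : Type u} [Field k] [Field κ] [Algebra k κ]

/-- Specialization of the last variable to `ρ`, with the other two renamed to `X` and `Y`. -/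
noncomputable def spec (k : Type u) {κ : Type u} [Field k] [Field κ] [Algebra k κ] (ρ : κ) :
    MvPolynomial (Fin 3) k →ₐ[k] κ[X][Y] :=
  MvPolynomial.aeval ![C X, Y, C (C ρ)]

/-- Evaluation of a bivariate polynomial over `κ` at a point of an extension of `κ`. -/
noncomputable def evalPoint {L : Type v} [Field L] (σ : κ →+* L) (x y : L) : κ[X][Y] →+* L :=
  eval₂RingHom (eval₂RingHom σ x) y

theorem evalPoint_add_mul_pow {L : Type v} [Field L] (σ : κ →+* L) (x y : L) (f g : κ[X][Y])
    (c : κ) (n : ℕ) :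
    evalPoint σ x y (f + C (C c) * g ^ n) =
      evalPoint σ x y f + σ c * evalPoint σ x y g ^ n := by
  rw [map_add, map_mul, map_pow]
  simp [evalPoint]

theorem evalPoint_spec {L : Type v} [Field L] [Algebra k L] (σ : κ →ₐ[k] L) (ρ : κ)
    {x : Fin 3 → L} (hx : x 2 = σ ρ) (p : MvPolynomial (Fin 3) k) :
    evalPoint (σ : κ →+* L) (x 0) (x 1) (spec k ρ p) = MvPolynomial.aeval x p := by
  induction p using MvPolynomial.induction_on with
  | C c =>
    have : spec k ρ (MvPolynomial.C c) = C (C (algebraMap k κ c)) := by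
      simp only [spec, MvPolynomial.aeval_C]; rfl
    rw [this]
    simp [evalPoint]
  | add p q hp hq => simp only [map_add, hp, hq]
  | mul_X p i hp =>
    rw [map_mul, map_mul, map_mul, hp]
    congr 1
    fin_cases i <;> simp [spec, evalPoint, hx]

theorem spec_pderiv (ρ : κ) (p : MvPolynomial (Fin 3) k) :
    spec k ρ (MvPolynomial.pderiv 0 p) = derivX κ (spec k ρ p) ∧
      spec k ρ (MvPolynomial.pderiv 1 p) = derivY κ (spec k ρ p) := by
  have hC : ∀ c : κ, derivX κ (C (C c)) = 0 ∧ derivY κ (C (C c)) = 0 := fun c =>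
    ⟨(derivX κ).map_algebraMap c, (derivY κ).map_algebraMap c⟩
  induction p using MvPolynomial.induction_on with
  | C c =>
    have : spec k ρ (MvPolynomial.C c) = C (C (algebraMap k κ c)) := by
      simp only [spec, MvPolynomial.aeval_C]; rfl
    rw [this, (hC _).1, (hC _).2]
    simp
  | add p q hp hq => simp only [map_add, hp.1, hp.2, hq.1, hq.2, and_self]
  | mul_X p i hp =>
    have hX : spec k ρ (MvPolynomial.pderiv 0 (MvPolynomial.X i)) =
        derivX κ (spec k ρ (MvPolynomial.X i)) ∧
        spec k ρ (MvPolynomial.pderiv 1 (MvPolynomial.X i)) =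
        derivY κ (spec k ρ (MvPolynomial.X i)) := by
      fin_cases i
      · simp [spec, MvPolynomial.pderiv_X, derivX_C, derivY_apply]
      · simp [spec, MvPolynomial.pderiv_X, derivX_Y, derivY_apply]
      · simp [spec, MvPolynomial.pderiv_X, (hC ρ).1, (hC ρ).2]
    simp only [map_mul, Derivation.leibniz, smul_eq_mul, map_add, hp.1, hp.2, hX.1, hX.2, and_self]

theorem adjoin_spec {F : GA 3 k} (hF : comp F 2 = MvPolynomial.X 2) (ρ : κ) :
    Algebra.adjoin κ {spec k ρ (comp F 0), spec k ρ (comp F 1)} = ⊤ := by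
  set S := Algebra.adjoin κ {spec k ρ (comp F 0), spec k ρ (comp F 1)} with hS
  have hC : ∀ c : κ, C (C c) ∈ S := fun c => S.algebraMap_mem c
  have hcomp : ∀ i, spec k ρ (comp F i) ∈ S := by
    intro i
    fin_cases i
    · exact Algebra.subset_adjoin (by simp)
    · exact Algebra.subset_adjoin (by simp)
    · have : spec k ρ (comp F 2) = C (C ρ) := by rw [hF]; simp [spec]
      simp only [Fin.reduceFinMk]
      rw [this]
      exact hC ρ
  have hunop : ∀ q, spec k ρ (F.unop q) ∈ S := by
    intro q
    rw [unop_apply]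
    induction q using MvPolynomial.induction_on with
    | C c =>
      rw [MvPolynomial.aeval_C, AlgHom.commutes]
      exact hC (algebraMap k κ c)
    | add p q hp hq => rw [map_add, map_add]; exact add_mem hp hq
    | mul_X p i hp =>
      rw [map_mul, map_mul, MvPolynomial.aeval_X]
      exact mul_mem hp (hcomp i)
  have hX : C X ∈ S := by
    have := hunop (F.unop.symm (MvPolynomial.X 0))
    rw [AlgEquiv.apply_symm_apply] at this
    simpa [spec] using this
  have hY : (Y : κ[X][Y]) ∈ S := by
    have := hunop (F.unop.symm (MvPolynomial.X 1))
    rw [AlgEquiv.apply_symm_apply] at this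
    simpa [spec] using this
  rw [eq_top_iff]
  intro p hp
  clear hp
  induction p using Polynomial.induction_on' with
  | add p q hp hq => exact add_mem hp hq
  | monomial n a =>
    rw [← C_mul_X_pow_eq_monomial]
    refine mul_mem ?_ (pow_mem hY n)
    induction a using Polynomial.induction_on' with
    | add p q hp hq => rw [C_add]; exact add_mem hp hq
    | monomial n a =>
      rw [← C_mul_X_pow_eq_monomial, C_mul, C_pow]
      exact mul_mem (hC a) (pow_mem hX n)

/-- Over the zeros `σ ρ` of one irreducible polynomial, an automorphism fixing the last variable,
with Jacobian determinant one, is imitated by a tame automorphism which is the identity over the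
zeros of `R`. The elementary factors over the residue field `κ` are lifted to `k[X 2]` by means of
the Chinese remainder theorem, which is the hypothesis `hlift`. -/
theorem exists_tame_of_lift {F : GA 3 k} (hF : comp F 2 = MvPolynomial.X 2)
    (hJ : jac (MvPolynomial.pderiv 0) (MvPolynomial.pderiv 1) (comp F 0) (comp F 1) = 1)
    {R : k[X]} (ρ : κ) (hlift : ∀ c : κ, ∃ e : k[X], aeval ρ e = c ∧ R ∣ e) :
    ∃ G ∈ TA 3 k, ∀ (L : Type v) [Field L] [Algebra k L] (x : Fin 3 → L),
      (∀ σ : κ →ₐ[k] L, x 2 = σ ρ → evalMap L G x = evalMap L F x) ∧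
      (aeval (x 2) R = 0 → evalMap L G x = x) := by
  have hj : jac (derivX κ) (derivY κ) (spec k ρ (comp F 0)) (spec k ρ (comp F 1)) = 1 := by
    have h := congrArg (spec k ρ) hJ
    simpa only [jac, map_sub, map_mul, (spec_pderiv ρ _).1, (spec_pderiv ρ _).2, map_one] using h
  have main := plane_induction
    (M := fun f g => ∃ G ∈ TA 3 k, ∀ (L : Type v) [Field L] [Algebra k L] (x : Fin 3 → L),
      (∀ σ : κ →ₐ[k] L, x 2 = σ ρ → evalMap L G x =
        ![evalPoint (σ : κ →+* L) (x 0) (x 1) f, evalPoint (σ : κ →+* L) (x 0) (x 1) g, x 2]) ∧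
      (aeval (x 2) R = 0 → evalMap L G x = x)) ?_ ?_ ?_ (adjoin_spec hF ρ) hj
  · obtain ⟨G, hG, hG'⟩ := main
    refine ⟨G, hG, fun L _ _ x => ⟨fun σ hx => ?_, (hG' L x).2⟩⟩
    rw [(hG' L x).1 σ hx]
    funext i
    fin_cases i
    · exact evalPoint_spec σ ρ hx _
    · exact evalPoint_spec σ ρ hx _
    · simp [evalMap, hF]
  · refine ⟨1, one_mem _, fun L _ _ x => ⟨fun σ hx => ?_, fun _ => evalMap_one L x⟩⟩
    rw [evalMap_one]
    funext i
    fin_cases i <;> simp [evalPoint]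
  · rintro f g c n ⟨G, hG, hG'⟩
    obtain ⟨e, rfl, hR⟩ := hlift c
    obtain ⟨E, hE, hE'⟩ := exists_shear.{v} (i := 0) (j := 1) (l := 2) (by decide) (by decide) n e
    refine ⟨E * G, mul_mem hE hG, fun L _ _ x => ⟨fun σ hx => ?_, fun hx => ?_⟩⟩
    · rw [evalMap_mul, (hG' L x).1 σ hx, hE']
      funext i
      fin_cases i
      · simp [evalPoint_add_mul_pow, hx, aeval_algHom_apply]
      · simp
      · simp
    · rw [evalMap_mul, (hG' L x).2 hx, hE', aeval_eq_zero_of_dvd_aeval_eq_zero hR hx]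
      simp
  · rintro f g c n ⟨G, hG, hG'⟩
    obtain ⟨e, rfl, hR⟩ := hlift c
    obtain ⟨E, hE, hE'⟩ := exists_shear.{v} (i := 1) (j := 0) (l := 2) (by decide) (by decide) n e
    refine ⟨E * G, mul_mem hE hG, fun L _ _ x => ⟨fun σ hx => ?_, fun hx => ?_⟩⟩
    · rw [evalMap_mul, (hG' L x).1 σ hx, hE']
      funext i
      fin_cases i
      · simp
      · simp [evalPoint_add_mul_pow, hx, aeval_algHom_apply]
      · simp
    · rw [evalMap_mul, (hG' L x).2 hx, hE', aeval_eq_zero_of_dvd_aeval_eq_zero hR hx]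
      simp

end Specialization

end PolyAut

/-! ### Tame automorphisms with prescribed values over finite fields -/

namespace PolyAut

open Polynomial

section Mimicking

variable {k : Type u} [Field k]

/-- `exists_tame_of_lift` for the residue field of an irreducible polynomial `P` coprime to `R`. -/
theorem exists_tame_of_irreducible {F : GA 3 k} (hF : comp F 2 = MvPolynomial.X 2)
    (hJ : jac (MvPolynomial.pderiv 0) (MvPolynomial.pderiv 1) (comp F 0) (comp F 1) = 1)
    {P R : k[X]} (hP : Irreducible P) (hPR : IsCoprime P R) :
    ∃ G ∈ TA 3 k, ∀ (L : Type v) [Field L] [Algebra k L] (x : Fin 3 → L),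
      (aeval (x 2) P = 0 → evalMap L G x = evalMap L F x) ∧
      (aeval (x 2) R = 0 → evalMap L G x = x) := by
  have : Fact (Irreducible P) := ⟨hP⟩
  obtain ⟨G, hG, hG'⟩ := exists_tame_of_lift.{v} (κ := AdjoinRoot P) hF hJ (R := R)
    (AdjoinRoot.root P) (by
      intro c
      obtain ⟨e, rfl⟩ := AdjoinRoot.mk_surjective c
      obtain ⟨a, b, hab⟩ := hPR
      refine ⟨e * (b * R), ?_, dvd_mul_of_dvd_right (dvd_mul_left _ _) _⟩
      rw [AdjoinRoot.aeval_eq, AdjoinRoot.mk_eq_mk]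
      exact ⟨-(e * a), by linear_combination e * hab⟩)
  refine ⟨G, hG, fun L _ _ x => ⟨fun hx => ?_, (hG' L x).2⟩⟩
  refine (hG' L x).1 (AdjoinRoot.liftAlgHom P (Algebra.ofId k L) (x 2) hx) ?_
  exact (AdjoinRoot.liftAlgHom_root ..).symm

/-- The tame automorphisms belonging to the members of a finite set `T` of irreducible polynomials
can be glued: each acts trivially over the zeros of the other members, so their product does
what is wanted over all of them. -/
theorem exists_tame_of_finset {F : GA 3 k} (hF : comp F 2 = MvPolynomial.X 2)
    (hJ : jac (MvPolynomial.pderiv 0) (MvPolynomial.pderiv 1) (comp F 0) (comp F 1) = 1)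
    (T : Finset k[X]) (hT : ∀ P ∈ T, Irreducible P)
    (hcop : ∀ P ∈ T, ∀ Q ∈ T, P ≠ Q → IsCoprime P Q) :
    ∃ G ∈ TA 3 k, ∀ (L : Type v) [Field L] [Algebra k L] (x : Fin 3 → L),
      (∃ P ∈ T, aeval (x 2) P = 0) → evalMap L G x = evalMap L F x := by
  classical
  have hF2 : ∀ (L : Type v) [Field L] [Algebra k L] (x : Fin 3 → L), evalMap L F x 2 = x 2 := by
    intro L _ _ x
    simp [evalMap, hF]
  suffices H : ∀ S ⊆ T, ∃ G ∈ TA 3 k, ∀ (L : Type v) [Field L] [Algebra k L] (x : Fin 3 → L),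
      (∀ P ∈ S, aeval (x 2) P = 0 → evalMap L G x = evalMap L F x) ∧
      (∀ P ∈ T, P ∉ S → aeval (x 2) P = 0 → evalMap L G x = x) by
    obtain ⟨G, hG, hG'⟩ := H T subset_rfl
    refine ⟨G, hG, fun L _ _ x hx => ?_⟩
    obtain ⟨P, hP, hx⟩ := hx
    exact (hG' L x).1 P hP hx
  intro S
  induction S using Finset.induction_on with
  | empty =>
    intro _
    exact ⟨1, one_mem _, fun L _ _ x => ⟨by simp, fun _ _ _ _ => evalMap_one L x⟩⟩
  | insert P S hPS ih =>
    intro hS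
    obtain ⟨G, hG, hG'⟩ := ih ((Finset.subset_insert _ _).trans hS)
    have hPT : P ∈ T := hS (Finset.mem_insert_self _ _)
    obtain ⟨G₂, hG₂, hG₂'⟩ := exists_tame_of_irreducible.{v} hF hJ (hT P hPT)
      (R := ∏ Q ∈ T.erase P, Q) (IsCoprime.prod_right fun Q hQ =>
        hcop P hPT Q (Finset.mem_of_mem_erase hQ) (Finset.ne_of_mem_erase hQ).symm)
    have hid : ∀ (L : Type v) [Field L] [Algebra k L] (x : Fin 3 → L), ∀ Q ∈ T, Q ≠ P →
        aeval (x 2) Q = 0 → evalMap L G₂ x = x := by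
      intro L _ _ x Q hQ hne hx
      refine (hG₂' L x).2 ?_
      exact aeval_eq_zero_of_dvd_aeval_eq_zero
        (Finset.dvd_prod_of_mem _ (Finset.mem_erase.2 ⟨hne, hQ⟩)) hx
    refine ⟨G * G₂, mul_mem hG hG₂, fun L _ _ x => ⟨fun Q hQ hx => ?_, fun Q hQ hQS hx => ?_⟩⟩
    · rw [evalMap_mul]
      rcases Finset.mem_insert.1 hQ with rfl | hQS
      · rw [(hG₂' L x).1 hx]
        exact (hG' L _).2 Q hPT hPS (by rw [hF2, hx])
      · rw [hid L x Q (hS hQ) (fun h => hPS (h ▸ hQS)) hx]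
        exact (hG' L x).1 Q hQS hx
    · rw [Finset.mem_insert, not_or] at hQS
      rw [evalMap_mul, hid L x Q hQ hQS.1 hx]
      exact (hG' L x).2 Q hQ hQS.2 hx

/-- The coordinates of points over the extension of degree `m` are zeros of the irreducible factors
of `X ^ q ^ m - X`. -/
theorem exists_finset_irreducible [Finite k] {m : ℕ} (hm : 0 < m) :
    ∃ T : Finset k[X], (∀ P ∈ T, Irreducible P) ∧
      (∀ P ∈ T, ∀ Q ∈ T, P ≠ Q → IsCoprime P Q) ∧
      ∀ (L : Type v) [Field L] [Algebra k L], Nat.card L = Nat.card k ^ m →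
        ∀ z : L, ∃ P ∈ T, aeval z P = 0 := by
  classical
  set A : k[X] := X ^ (Nat.card k ^ m) - X with hA
  have hA0 : A ≠ 0 := FiniteField.X_pow_card_sub_X_ne_zero k
    (Nat.one_lt_pow hm.ne' Finite.one_lt_card)
  refine ⟨(UniqueFactorizationMonoid.normalizedFactors A).toFinset, ?_, ?_, ?_⟩
  · intro P hP
    exact UniqueFactorizationMonoid.irreducible_of_normalized_factor P (Multiset.mem_toFinset.1 hP)
  · intro P hP Q hQ hne
    rw [Multiset.mem_toFinset] at hP hQ
    have hPi := UniqueFactorizationMonoid.irreducible_of_normalized_factor P hP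
    have hQi := UniqueFactorizationMonoid.irreducible_of_normalized_factor Q hQ
    rw [hPi.coprime_iff_not_dvd]
    intro hdvd
    apply hne
    rw [← UniqueFactorizationMonoid.normalize_normalized_factor P hP,
      ← UniqueFactorizationMonoid.normalize_normalized_factor Q hQ]
    exact normalize_eq_normalize_iff_associated.2 (hPi.associated_of_dvd hQi hdvd)
  · intro L _ _ hL z
    have hLpos : 0 < Nat.card L := by
      rw [hL]; exact pow_pos Finite.card_pos _
    have : Finite L := Nat.finite_of_card_ne_zero hLpos.ne'
    have := Fintype.ofFinite L
    have hz : aeval z A = 0 := by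
      rw [hA, map_sub, map_pow, aeval_X, ← hL, Nat.card_eq_fintype_card, FiniteField.pow_card,
        sub_self]
    have hz2 : aeval z (UniqueFactorizationMonoid.normalizedFactors A).prod = 0 :=
      aeval_eq_zero_of_dvd_aeval_eq_zero
        (UniqueFactorizationMonoid.prod_normalizedFactors hA0).symm.dvd hz
    rw [map_multiset_prod, Multiset.prod_eq_zero_iff, Multiset.mem_map] at hz2
    obtain ⟨P, hP, hP'⟩ := hz2
    exact ⟨P, Multiset.mem_toFinset.2 hP, hP'⟩

/-- Every point of the extension of degree `m` lies over a zero of one of the irreducible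
polynomials of `exists_finset_irreducible`, so gluing over these gives the tame automorphism. -/
theorem exists_tame_of_comp_two [Finite k] {F : GA 3 k} (hF : comp F 2 = MvPolynomial.X 2) {m : ℕ}
    (hm : 0 < m) :
    ∃ G ∈ TA 3 k, ∀ (L : Type v) [Field L] [Algebra k L], Nat.card L = Nat.card k ^ m →
      ∀ x : Fin 3 → L, evalMap L G x = evalMap L F x := by
  obtain ⟨c, hc, hJ⟩ := exists_jac_eq_C hF
  obtain ⟨D, hD, hD'⟩ := exists_scaling (0 : Fin 3) hc
  obtain ⟨D₂, hD₂, hD₂'⟩ := exists_scaling (0 : Fin 3) (inv_ne_zero hc)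
  obtain ⟨T, hT, hcop, hroot⟩ := exists_finset_irreducible.{v} (k := k) hm
  -- After a scaling the Jacobian determinant is one.
  have h0 : comp (D₂ * F) 0 = MvPolynomial.C c⁻¹ * comp F 0 := by
    rw [comp_mul, hD₂', Function.update_self, map_mul, MvPolynomial.aeval_X,
      ← MvPolynomial.algebraMap_eq, AlgHom.commutes]
  have h1 : comp (D₂ * F) 1 = comp F 1 := by
    rw [comp_mul, hD₂', Function.update_of_ne (by decide), MvPolynomial.aeval_X]
  have h2 : comp (D₂ * F) 2 = MvPolynomial.X 2 := by
    rw [comp_mul, hD₂', Function.update_of_ne (by decide), MvPolynomial.aeval_X, hF]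
  obtain ⟨G, hG, hG'⟩ := exists_tame_of_finset.{v} h2 (by
    have h3 : (MvPolynomial.C c⁻¹ : MvPolynomial (Fin 3) k) * MvPolynomial.C c = 1 := by
      rw [← MvPolynomial.C_mul, inv_mul_cancel₀ hc, MvPolynomial.C_1]
    rw [h0, h1, ← h3, ← hJ]
    simp only [jac, Derivation.leibniz, MvPolynomial.pderiv_C, smul_eq_mul]
    ring) T hT hcop
  refine ⟨D * G, mul_mem hD hG, fun L _ _ hL x => ?_⟩
  rw [evalMap_mul, hG' L x (hroot L hL (x 2)), evalMap_mul, evalMap_scaling hD₂',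
    evalMap_scaling hD']
  have hcL : algebraMap k L c ≠ 0 := by simpa using hc
  rw [Function.update_idem, Function.update_self, map_inv₀, mul_inv_cancel_left₀ hcL,
    Function.update_eq_self]

theorem FixesVariable.isMimickable [Finite k] {F : GA 3 k} (hF : FixesVariable F) :
    IsMimickable.{v, u} (TA 3 k) F := by
  intro m hm
  obtain ⟨i, hi⟩ := hF
  obtain ⟨A, hA, hA'⟩ := exists_swap (k := k) i 2
  have hcomp : comp (A * F * A) 2 = MvPolynomial.X 2 := by
    rw [comp_mul, comp_mul, hA', MvPolynomial.aeval_X, Equiv.swap_apply_right, hi,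
      MvPolynomial.aeval_X, Equiv.swap_apply_left]
  have hAA : A * A = 1 := by
    apply ext_comp
    intro j
    rw [comp_mul, hA', MvPolynomial.aeval_X, Equiv.swap_apply_self, comp_one]
  obtain ⟨G, hG, hG'⟩ := exists_tame_of_comp_two.{v} hcomp hm
  refine ⟨A * G * A, mul_mem (mul_mem hA hG) hA, fun L _ _ hL => ?_⟩
  have hGF : inducedPerm 3 k L G = inducedPerm 3 k L (A * F * A) := by
    ext1 x
    exact hG' L hL x
  rw [map_mul, map_mul, hGF, ← map_mul, ← map_mul]
  congr 1
  rw [show A * (A * F * A) * A = (A * A) * F * (A * A) by group, hAA, one_mul, mul_one]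

end Mimicking

end PolyAut

theorem mainTheorem1 {k : Type u} [Field k] [Finite k] :
    (∀ F : PolyAut.GA 3 k, PolyAut.FixesVariable F →
      PolyAut.IsMimickable.{v, u} (PolyAut.TA 3 k) F ∧
      ∀ (m : ℕ) (L : Type v) [Field L] [Algebra k L], 0 < m → Nat.card L = Nat.card k ^ m →
        PolyAut.inducedPerm 3 k L F ∈ (PolyAut.TA 3 k).map (PolyAut.inducedPerm 3 k L)) ∧
    PolyAut.FixesVariable (PolyAut.nagata k) ∧
    PolyAut.IsMimickable.{v, u} (PolyAut.TA 3 k) (PolyAut.nagata k) := by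
  have hN : PolyAut.FixesVariable (PolyAut.nagata k) := ⟨2, by rw [PolyAut.comp_nagata]; rfl⟩
  refine ⟨fun F hF => ⟨hF.isMimickable, fun m L _ _ hm hL => ?_⟩, hN, hN.isMimickable⟩
  obtain ⟨G, hG, hG'⟩ := hF.isMimickable m hm
  exact ⟨G, hG, (hG' L hL).symm⟩
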